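/- Let $f:\mathbb{R}^d\to\mathbb{R}$ ($d\ge 1$) be $\mu$-strongly convex ($\mu>0$) and $L$-smooth, meaning that $f$ is differentiable and $|\nabla f(x)-\nabla f(y)|\le L|x-y|$ for all $x,y$. Put $\kappa=L/\mu$ and $f^*=\min f$. Let $h,\eta,R_1,R_2>0$. Let $x^0_1,\dots,x^0_N$ be i.i.d. random vectors in $\mathbb{R}^d$, and let $\xi^m_i$ ($m\ge 0$, $1\le i\le N$) be i.i.d. $\mathcal{N}(0,I_d)$ vectors, independent of $(x^0_i)_i$. The classical Langevin Monte Carlo particles are $$z^0_i=x^0_i,\qquad z^{m+1}_i=z^m_i-h\nabla f(z^m_i)+\sqrt{2h}\,\xi^m_i .$$ The constrained ensemble Langevin Monte Carlo particles, with parameters $h,\eta,R_1,R_2,N^*,M_f$, are $$x^{m+1}_i=w^{m+1}_i+\sqrt{2h}\,\xi^m_i,\qquad w^{m+1}_i=x^m_i-hF^m_i .$$ Here $F^0_i=\nabla f(x^0_i)$. For $m\ge 1$ let $N^m_i=\#\{j\ne i:\ |w^m_j-w^m_i|\le R_2\}$. Then $F^m_i=\nabla f(x^m_i)$ if $\sqrt{2h}\,|\xi^{m-1}_i|>R_1$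 or $f(x^m_i)>M_f$ or $N^m_i<N^*$, and otherwise $$F^m_i=\frac1{N^m_i}\sum_{j\neq i}\alpha_d\,\frac{f(x^m_j)-f(x^m_i)}{|x^m_j-x^m_i|^2}\,\frac{x^m_j-x^m_i}{\mathrm{p}^m_j}\,\mathbf 1_{\{|x^m_j-x^m_i|\le\eta,\ |w^m_j-w^m_i|\le R_2\}},\qquad \mathrm{p}^m_j=\frac{e^{-|\xi^{m-1}_j|^2/2}}{(4\pi h)^{d/2}},$$ where $\alpha_d=d/V$ and $V$ is the volume of the ball of radius $\eta$ in $\mathbb{R}^d$. There are absolute constants $C,\varepsilon_0>0$ such that the following holds for every choice of the data above and all $0<\varepsilon\le\varepsilon_0$, $0<\rho<1$. If $$h\le\min\Big\{\frac1L,\frac1d\Big\},\qquad \max\{\eta,1\}\le R_2,\qquad \eta<\frac{\varepsilon}{\kappa d},\qquad M_f=(N^*)^\rho+f^*,$$ $$N^*=\frac{R_1^{d/(1-\rho)}\,\kappa^{1/(1-\rho)}\,d^{2/(1-\rho)}}{\mu^{1/(1-\rho)}\,\eta^{d/(1-\rho)}\,\varepsilon^{2/(1-\rho)}}\exp\!\left(\frac{R_2(R_2+R_1)}{2(1-\rho)h}\right),$$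 then for all $m\ge 0$ and $1\le i\le N$ the variable $|x^m_i-z^m_i|$ is integrable and $$\mathbb{E}\,|x^m_i-z^m_i|\le C\,\varepsilon .$$ -/

import Mathlib

open MeasureTheory ProbabilityTheory

noncomputable section

namespace CEnLMC

/-- The state space `ℝ^d` with the Euclidean norm. -/
abbrev Space (d : ℕ) : Type := EuclideanSpace ℝ (Fin d)

/-- `f` is `L`-smooth: differentiable with `L`-Lipschitz gradient. -/
def LSmooth {d : ℕ} (L : ℝ) (f : Space d → ℝ) : Prop :=
  Differentiable ℝ f ∧ ∀ x y, ‖gradient f x - gradient f y‖ ≤ L * ‖x - y‖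

/-- The numerical parameters of constrained ensemble Langevin Monte Carlo: the stepsize `h`, the
neighbourhood radius `η`, the constraint radii `R₁`, `R₂`, the minimal number of neighbours `Nstar`
and the threshold `Mf` for the values of `f`. -/
structure Params where
  h : ℝ
  η : ℝ
  R₁ : ℝ
  R₂ : ℝ
  Nstar : ℝ
  Mf : ℝ

/-- The constant `α_d = d / V`, where `V` is the volume of the ball of radius `η` in `ℝ^d`. -/
def alpha (d : ℕ) (η : ℝ) : ℝ :=
  d / (volume : Measure (Space d)).real (Metric.closedBall 0 η)

/-- For `ξ` the Gaussian increment that produced a particle, the number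
`(4πh)^{-d/2} exp(-|ξ|²/2)`, that is, the density of the law `N(w, 2h I_d)` at the new position
`w + √(2h) ξ`. -/
def density {d : ℕ} (h : ℝ) (ξ : Space d) : ℝ :=
  1 / (4 * Real.pi * h) ^ ((d : ℝ) / 2) * Real.exp (-‖ξ‖ ^ 2 / 2)

open Classical in
/-- The number `N_i` of indices `j ≠ i` with `|w_j - w_i| ≤ R₂`. -/
def neighbors {d N : ℕ} (p : Params) (w : Fin N → Space d) (i : Fin N) : ℕ :=
  (Finset.univ.filter fun j => j ≠ i ∧ ‖w j - w i‖ ≤ p.R₂).card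

open Classical in
/-- The contribution `F_{ij}` of particle `j` to the approximate gradient at particle `i`. Here `x`
are the current positions, `w` their deterministic parts and `ξ` the Gaussian increments that
produced them: `x = w + √(2h) ξ`. -/
def pairForce {d N : ℕ} (p : Params) (f : Space d → ℝ) (x w ξ : Fin N → Space d)
    (i j : Fin N) : Space d :=
  if ‖x j - x i‖ ≤ p.η ∧ ‖w j - w i‖ ≤ p.R₂ then
    (alpha d p.η * ((f (x j) - f (x i)) / ‖x j - x i‖ ^ 2) / density p.h (ξ j)) • (x j - x i)
  else 0

open Classical in
/-- The force `F_i`: the true gradient if one of the three constraints fails, and otherwise the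
ensemble average of the pairwise contributions. -/
def force {d N : ℕ} (p : Params) (f : Space d → ℝ) (x w ξ : Fin N → Space d)
    (i : Fin N) : Space d :=
  if p.R₁ < Real.sqrt (2 * p.h) * ‖ξ i‖ ∨ p.Mf < f (x i) ∨ (neighbors p w i : ℝ) < p.Nstar then
    gradient f (x i)
  else
    (1 / (neighbors p w i : ℝ)) •
      ∑ j ∈ Finset.univ.filter (fun j => j ≠ i), pairForce p f x w ξ i j

/-- The positions `x^m` together with the forces `F^m` of the constrained ensemble method, for
given initial positions `x₀` and given increments `ξ m i` (used in the step from `m` to `m + 1`).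
Initially the deterministic parts `w` are set to infinity, so that no particle has neighbours and
the force at time `0` is the true gradient. Afterwards `w^{m+1} = x^m - h F^m` and
`x^{m+1} = w^{m+1} + √(2h) ξ^m`. -/
def ensembleState {d N : ℕ} (p : Params) (f : Space d → ℝ) (x₀ : Fin N → Space d)
    (ξ : ℕ → Fin N → Space d) : ℕ → (Fin N → Space d) × (Fin N → Space d)
  | 0 => (x₀, fun i => gradient f (x₀ i))
  | m + 1 =>
    let s := ensembleState p f x₀ ξ m
    let w : Fin N → Space d := fun i => s.1 i - p.h • s.2 i
    let x : Fin N → Space d := fun i => w i + Real.sqrt (2 * p.h) • ξ m i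
    (x, force p f x w (ξ m))

/-- The particles `x^m_i` of constrained ensemble Langevin Monte Carlo. -/
def ensemble {d N : ℕ} (p : Params) (f : Space d → ℝ) (x₀ : Fin N → Space d)
    (ξ : ℕ → Fin N → Space d) (m : ℕ) (i : Fin N) : Space d :=
  (ensembleState p f x₀ ξ m).1 i

/-- The particles `z^m_i` of classical Langevin Monte Carlo. -/
def langevin {d N : ℕ} (h : ℝ) (f : Space d → ℝ) (x₀ : Fin N → Space d)
    (ξ : ℕ → Fin N → Space d) : ℕ → Fin N → Space d
  | 0 => x₀
  | m + 1 => fun i =>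
    langevin h f x₀ ξ m i - h • gradient f (langevin h f x₀ ξ m i) + Real.sqrt (2 * h) • ξ m i

/-- The randomness that drives both methods: i.i.d. initial positions `x₀ i` with law `ν`, and
standard Gaussian increments `ξ m i`, all of them mutually independent. -/
structure IsDriving {d N : ℕ} {Ω : Type*} [MeasurableSpace Ω] (P : Measure Ω)
    (ν : Measure (Space d)) (x₀ : Fin N → Ω → Space d) (ξ : ℕ → Fin N → Ω → Space d) : Prop where
  measurable_init : ∀ i, Measurable (x₀ i)
  measurable_noise : ∀ m i, Measurable (ξ m i)
  law_init : ∀ i, P.map (x₀ i) = ν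
  law_noise : ∀ m i, P.map (ξ m i) = stdGaussian (Space d)
  indep : iIndepFun (Sum.elim x₀ (fun q : ℕ × Fin N => ξ q.1 q.2)) P

end CEnLMC

end

noncomputable section
namespace CEnLMC
open scoped RealInnerProductSpace

/-! ### Smooth strongly convex functions -/

section SmoothConvex

variable {d : ℕ} {L μ : ℝ} {f : Space d → ℝ}

/-! Both methods are driven by the same noise, which cancels in `x - z`. The new difference is the
difference of two exact gradient steps minus `h (F - ∇f(x))`. The gradient step contracts by `1 -
hμ/2` (`norm_gradient_step_le`), so a mean force error of at most `7με` makes `14ε` a fixed point of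
the recursion for `E|x - z|`, which starts at `0`.

The force error is bounded with `w` frozen, uniformly in `w`; this suffices because `w` is
independent of the increments of its step. If a constraint fails, the error is zero. Otherwise the
weights `1/p_j` turn the laws of the neighbours into Lebesgue measure
(`measurePreserving_importance`), so every term has as mean an integral over the `η`-ball around
`x_i`. By the symmetries of the ball this mean is `∇f(x_i)` up to a Taylor error `dLη/2`
(`norm_integral_stencil_sub_le`).

The rest is variance. A neighbour within `η` of `x_i` has inverse density at most some `K` depending
on `|ξ_i|` (`one_div_density_le`), and the second moment of a term is linear in `K`. The mean
fluctuation is split by the arithmetic-geometric inequality with a parameter `t` proportional to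
`1/p_i`. The part with `t` then integrates to a multiple of the volume of the `R₁`-ball. The other
part contains `p_i K`, whose growth is `exp(R₂(R₂+R₁)/(2h))` up to the factors `exp(-1/(5h))` and
`exp(|ξ_i|²/10)` (`density_mul_inverseDensityBound_le`). The threshold `Mf` bounds the gradient,
`Nstar` absorbs the growth, and `exp(-1/(5h))` absorbs the remaining dependence on `d` and `L`
because `h ≤ min(1/L, 1/d)` (`noiseBound_le`). -/

lemma gradient_neg (f : Space d → ℝ) (x : Space d) :
    gradient (fun x => -f x) x = -gradient f x := by
  simp [gradient, fderiv_fun_neg]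

lemma LSmooth.neg (hf : LSmooth L f) : LSmooth L (fun x => -f x) := by
  refine ⟨hf.1.neg, fun x y => ?_⟩
  rw [gradient_neg, gradient_neg, ← norm_neg]
  simpa [sub_eq_add_neg, add_comm] using hf.2 x y

lemma hasDerivAt_along (hf : LSmooth L f) (x v : Space d) (t : ℝ) :
    HasDerivAt (fun t : ℝ => f (x + t • v)) ⟪gradient f (x + t • v), v⟫ t := by
  have h1 : HasDerivAt (fun t : ℝ => x + t • v) v t := by
    simpa using ((hasDerivAt_id t).smul_const v).const_add x
  have h2 := (hf.1 (x + t • v)).hasGradientAt.hasFDerivAt.comp_hasDerivAt t h1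
  rw [InnerProductSpace.toDual_apply_apply] at h2
  exact h2

/-- The descent lemma. -/
lemma LSmooth.le_quadratic (hf : LSmooth L f) (x y : Space d) :
    f y ≤ f x + ⟪gradient f x, y - x⟫ + L / 2 * ‖y - x‖ ^ 2 := by
  set v := y - x with hv
  -- By Cauchy-Schwarz and the Lipschitz bound, `φ' ≤ 0` on `(0, 1)`; comparing `φ 1` with `φ 0`
  -- gives the claim.
  let φ : ℝ → ℝ := fun t => f (x + t • v) - t * ⟪gradient f x, v⟫ - L / 2 * ‖v‖ ^ 2 * t ^ 2
  have hd : ∀ t, HasDerivAt φ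
      (⟪gradient f (x + t • v), v⟫ - ⟪gradient f x, v⟫ - L / 2 * ‖v‖ ^ 2 * (2 * t)) t := by
    intro t
    have h1 := hasDerivAt_along hf x v t
    have h2 := (hasDerivAt_id t).mul_const ⟪gradient f x, v⟫
    have h3 := ((hasDerivAt_id t).pow 2).const_mul (L / 2 * ‖v‖ ^ 2)
    exact ((h1.sub h2).sub h3).congr_deriv (by simp)
  have hanti : AntitoneOn φ (Set.Icc 0 1) := by
    refine antitoneOn_of_deriv_nonpos (convex_Icc 0 1)
      (fun t _ => (hd t).continuousAt.continuousWithinAt)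
      (fun t _ => (hd t).differentiableAt.differentiableWithinAt) fun t ht => ?_
    rw [interior_Icc] at ht
    rw [(hd t).deriv, ← inner_sub_left]
    have h1 := real_inner_le_norm (gradient f (x + t • v) - gradient f x) v
    have h2 := hf.2 (x + t • v) x
    rw [add_sub_cancel_left, norm_smul, Real.norm_of_nonneg ht.1.le] at h2
    nlinarith [norm_nonneg v]
  have := hanti (Set.left_mem_Icc.2 zero_le_one) (Set.right_mem_Icc.2 zero_le_one) zero_le_one
  simp only [φ, one_smul, zero_smul, add_zero, hv, add_sub_cancel] at this
  rw [hv]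
  linarith

lemma LSmooth.abs_sub_le_quadratic (hf : LSmooth L f) (x y : Space d) :
    |f y - f x - ⟪gradient f x, y - x⟫| ≤ L / 2 * ‖y - x‖ ^ 2 := by
  have h1 := hf.le_quadratic x y
  have h2 := hf.neg.le_quadratic x y
  rw [gradient_neg, inner_neg_left] at h2
  rw [abs_le]
  constructor <;> linarith

lemma LSmooth.continuous_gradient (hf : LSmooth L f) : Continuous (gradient f) := by
  refine (LipschitzWith.of_dist_le_mul (K := L.toNNReal) fun x y => ?_).continuous
  rw [dist_eq_norm, dist_eq_norm]
  exact (hf.2 x y).trans (by gcongr; exact Real.le_coe_toNNReal L)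

/-- Gradients of a smooth function are controlled by its excess over a lower bound. -/
lemma LSmooth.norm_gradient_sq_le (hL : 0 < L) (hf : LSmooth L f) {a : ℝ} (ha : ∀ x, a ≤ f x)
    (x : Space d) : ‖gradient f x‖ ^ 2 ≤ 2 * L * (f x - a) := by
  -- This point minimizes the quadratic upper bound at `x`.
  have h1 := hf.le_quadratic x (x - L⁻¹ • gradient f x)
  have h2 := ha (x - L⁻¹ • gradient f x)
  rw [sub_sub_cancel_left, inner_neg_right, real_inner_smul_right, real_inner_self_eq_norm_sq,
    norm_neg, norm_smul, mul_pow, Real.norm_of_nonneg (inv_nonneg.2 hL.le)] at h1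
  have h3 : a ≤ f x - ‖gradient f x‖ ^ 2 / (2 * L) := by
    refine (h2.trans h1).trans (le_of_eq ?_)
    field_simp
    ring
  have h4 : ‖gradient f x‖ ^ 2 / (2 * L) ≤ f x - a := by linarith
  rw [div_le_iff₀ (by positivity)] at h4
  linarith

/-- Strong convexity on the segment from `x` to `y`, divided by `t`, bounds the slope of `f` at `x`;
then `t → 0+`. -/
lemma strongConvexOn_quadratic_le (hf : LSmooth L f) (hc : StrongConvexOn Set.univ μ f)
    (x y : Space d) : f x + ⟪gradient f x, y - x⟫ + μ / 2 * ‖y - x‖ ^ 2 ≤ f y := by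
  have hd := hasDerivAt_along hf x (y - x) 0
  rw [zero_smul, add_zero, hasDerivAt_iff_tendsto_slope_zero] at hd
  have hd' := hd.mono_left (nhdsWithin_mono (0 : ℝ) (s := Set.Ioi 0) fun t ht => ne_of_gt ht)
  have hr : Filter.Tendsto (fun t : ℝ => f y - f x - (1 - t) * (μ / 2 * ‖y - x‖ ^ 2))
      (nhdsWithin 0 (Set.Ioi 0)) (nhds (f y - f x - (1 - 0) * (μ / 2 * ‖y - x‖ ^ 2))) := by
    apply Filter.Tendsto.mono_left _ nhdsWithin_le_nhds
    exact Continuous.tendsto (by fun_prop) 0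
  have := le_of_tendsto_of_tendsto hd' hr ?_
  · linarith
  filter_upwards [Ioo_mem_nhdsGT (zero_lt_one (α := ℝ))] with t ht
  have h := hc.2 (Set.mem_univ x) (Set.mem_univ y) (sub_nonneg.2 ht.2.le) ht.1.le (by ring)
  have he : (1 - t) • x + t • y = x + t • (y - x) := by module
  rw [he, norm_sub_rev] at h
  simp only [smul_eq_mul, zero_add, zero_smul, add_zero] at h ⊢
  rw [inv_mul_le_iff₀ ht.1]
  linarith

/-- The quadratic lower and upper bounds are compared at a unit vector, which exists because `d >
0`. -/
lemma modulus_le_of_smooth (hd : 0 < d) (hf : LSmooth L f) (hc : StrongConvexOn Set.univ μ f) :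
    μ ≤ L := by
  have h1 := hf.le_quadratic 0 (EuclideanSpace.single ⟨0, hd⟩ 1)
  have h2 := strongConvexOn_quadratic_le hf hc 0 (EuclideanSpace.single ⟨0, hd⟩ 1)
  simp only [sub_zero, PiLp.norm_single, norm_one, one_pow, mul_one] at h1 h2
  linarith

/-- The gradient of a smooth convex function is cocoercive. -/
lemma cocoercive_gradient (hL : 0 < L) (hμ : 0 < μ) (hf : LSmooth L f)
    (hc : StrongConvexOn Set.univ μ f) (x y : Space d) :
    ‖gradient f x - gradient f y‖ ^ 2 ≤ L * ⟪gradient f x - gradient f y, x - y⟫ := by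
  -- The lower bound from `x` and the upper bound from `y` are compared at `y - L⁻¹ g`, the
  -- minimizer of the gap between the affine lower bound at `x` and the quadratic upper bound at
  -- `y`. Adding the two inequalities with `x` and `y` exchanged gives cocoercivity.
  have key : ∀ x y, f x + ⟪gradient f x, y - x⟫ +
      ‖gradient f x - gradient f y‖ ^ 2 / (2 * L) ≤ f y := by
    intro x y
    set g := gradient f y - gradient f x with hg
    have h1 := strongConvexOn_quadratic_le hf hc x (y - L⁻¹ • g)
    have h2 := hf.le_quadratic y (y - L⁻¹ • g)
    rw [sub_sub_cancel_left, inner_neg_right, real_inner_smul_right,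
      norm_neg, norm_smul, mul_pow, Real.norm_of_nonneg (inv_nonneg.2 hL.le)] at h2
    rw [show y - L⁻¹ • g - x = (y - x) - L⁻¹ • g by abel, inner_sub_right,
      real_inner_smul_right] at h1
    have h3 : 0 ≤ μ / 2 * ‖y - x - L⁻¹ • g‖ ^ 2 := by positivity
    have h4 : ⟪gradient f y, g⟫ - ⟪gradient f x, g⟫ = ‖g‖ ^ 2 := by
      rw [← inner_sub_left, ← hg, real_inner_self_eq_norm_sq]
    have h5 : L⁻¹ * ⟪gradient f y, g⟫ - L⁻¹ * ⟪gradient f x, g⟫ = L⁻¹ * ‖g‖ ^ 2 := by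
      rw [← mul_sub, h4]
    have h6 : L⁻¹ * ‖g‖ ^ 2 - L / 2 * (L⁻¹ ^ 2 * ‖g‖ ^ 2) = ‖g‖ ^ 2 / (2 * L) := by
      field_simp
      ring
    rw [norm_sub_rev, ← hg]
    linarith
  have h1 := key x y
  have h2 := key y x
  rw [norm_sub_rev (gradient f y)] at h2
  rw [← neg_sub x y, inner_neg_right] at h1
  rw [inner_sub_left]
  have h3 : ‖gradient f x - gradient f y‖ ^ 2 / L =
      2 * (‖gradient f x - gradient f y‖ ^ 2 / (2 * L)) := by
    field_simp
  have h4 : ‖gradient f x - gradient f y‖ ^ 2 / L ≤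
      ⟪gradient f x, x - y⟫ - ⟪gradient f y, x - y⟫ := by linarith
  rw [div_le_iff₀ hL] at h4
  linarith

/-- A gradient step with stepsize at most `1 / L` is a contraction. -/
lemma norm_gradient_step_le {h : ℝ} (hL : 0 < L) (hμ : 0 < μ) (hf : LSmooth L f)
    (hc : StrongConvexOn Set.univ μ f) (hh : 0 < h) (hhL : h ≤ 1 / L) (hhμ : h * μ ≤ 1)
    (x y : Space d) :
    ‖(x - h • gradient f x) - (y - h • gradient f y)‖ ≤ (1 - h * μ / 2) * ‖x - y‖ := by
  set g := gradient f x - gradient f y with hg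
  have h1 := cocoercive_gradient hL hμ hf hc x y
  have h2 : μ * ‖x - y‖ ^ 2 ≤ ⟪g, x - y⟫ := by
    have a := strongConvexOn_quadratic_le hf hc x y
    have b := strongConvexOn_quadratic_le hf hc y x
    rw [norm_sub_rev, ← neg_sub x y, inner_neg_right] at a
    rw [hg, inner_sub_left]
    linarith
  rw [← hg] at h1
  have hin : 0 ≤ ⟪g, x - y⟫ := le_trans (by positivity) h2
  have h3 : h * ‖g‖ ^ 2 ≤ ⟪g, x - y⟫ := by
    calc h * ‖g‖ ^ 2 ≤ 1 / L * (L * ⟪g, x - y⟫) := by gcongr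
      _ = ⟪g, x - y⟫ := by field_simp
  rw [show (x - h • gradient f x) - (y - h • gradient f y) = (x - y) - h • g by
    rw [hg]; module]
  refine abs_le_of_sq_le_sq' ?_ (mul_nonneg (by linarith) (norm_nonneg _)) |>.2
  rw [norm_sub_sq_real, real_inner_smul_right, norm_smul, Real.norm_of_nonneg hh.le,
    real_inner_comm]
  -- With `Δ = x - y`: `|Δ|² - 2h⟪g, Δ⟫ + h²|g|² ≤ |Δ|² - h⟪g, Δ⟫ ≤ (1 - hμ)|Δ|² ≤ (1 - hμ/2)²|Δ|²`.
  nlinarith [sq_nonneg (h * μ * ‖x - y‖), mul_le_mul_of_nonneg_left h3 hh.le,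
    mul_le_mul_of_nonneg_left h2 hh.le]

end SmoothConvex

/-! ### The density of the Gaussian measure and importance sampling -/

section GaussianDensity

variable {d : ℕ}

/-- The Lebesgue density of the standard Gaussian measure on `ℝ^d`. -/
def gaussianWeight (d : ℕ) (x : Space d) : ℝ :=
  ((2 * Real.pi) ^ ((d : ℝ) / 2))⁻¹ * Real.exp (-(1 / 2) * ‖x‖ ^ 2)

lemma gaussianWeight_nonneg (x : Space d) : 0 ≤ gaussianWeight d x := by
  unfold gaussianWeight; positivity

lemma measurable_gaussianWeight : Measurable (gaussianWeight d) := by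
  unfold gaussianWeight; fun_prop

lemma lintegral_exp_neg_mul_sq_norm {b : ℝ} (hb : 0 < b) :
    ∫⁻ x : Space d, ENNReal.ofReal (Real.exp (-b * ‖x‖ ^ 2)) =
      ENNReal.ofReal ((Real.pi / b) ^ ((d : ℝ) / 2)) := by
  have h := GaussianFourier.integral_rexp_neg_mul_sq_norm (V := Space d) hb
  rw [finrank_euclideanSpace_fin] at h
  rw [← h, ofReal_integral_eq_lintegral_ofReal]
  · refine Integrable.of_integral_ne_zero ?_
    rw [h]
    positivity
  · exact Filter.Eventually.of_forall fun x => (Real.exp_pos _).le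

lemma lintegral_gaussianWeight :
    ∫⁻ x : Space d, ENNReal.ofReal (gaussianWeight d x) = 1 := by
  have e : ∀ x : Space d, ENNReal.ofReal (gaussianWeight d x) =
      ENNReal.ofReal ((2 * Real.pi) ^ ((d : ℝ) / 2))⁻¹ *
        ENNReal.ofReal (Real.exp (-(1 / 2) * ‖x‖ ^ 2)) := fun x => by
    rw [gaussianWeight, ENNReal.ofReal_mul (by positivity)]
  simp_rw [e]
  rw [lintegral_const_mul _ (by fun_prop), lintegral_exp_neg_mul_sq_norm (by norm_num),
    ← ENNReal.ofReal_mul (by positivity), show Real.pi / (1 / 2) = 2 * Real.pi by ring,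
    inv_mul_cancel₀ (by positivity), ENNReal.ofReal_one]

/-- The standard Gaussian measure has the usual density. -/
lemma stdGaussian_eq_withDensity :
    stdGaussian (Space d) = volume.withDensity fun x => ENNReal.ofReal (gaussianWeight d x) := by
  have : IsFiniteMeasure (volume.withDensity fun x => ENNReal.ofReal (gaussianWeight d x)) :=
    isFiniteMeasure_withDensity (by rw [lintegral_gaussianWeight]; exact ENNReal.one_ne_top)
  refine Measure.ext_of_charFun (funext fun t => ?_)
  rw [charFun_stdGaussian, charFun_apply, integral_withDensity_eq_integral_toReal_smul
    measurable_gaussianWeight.ennreal_ofReal (Filter.Eventually.of_forall fun _ =>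
      ENNReal.ofReal_lt_top)]
  have h := GaussianFourier.integral_cexp_neg_mul_sq_norm_add (V := Space d) (b := 1 / 2)
    (by norm_num) Complex.I t
  have e : ∀ x : Space d, (ENNReal.ofReal (gaussianWeight d x)).toReal •
      Complex.exp ((⟪x, t⟫ : ℝ) * Complex.I) = (((2 * Real.pi) ^ ((d : ℝ) / 2))⁻¹ : ℝ) *
        Complex.exp (-(1 / 2) * (‖x‖ : ℂ) ^ 2 + Complex.I * (⟪t, x⟫ : ℝ)) := by
    intro x
    rw [ENNReal.toReal_ofReal (gaussianWeight_nonneg x), gaussianWeight, Complex.exp_add,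
      real_inner_comm, Complex.real_smul]
    push_cast
    ring_nf
  simp_rw [e]
  rw [integral_const_mul, h, finrank_euclideanSpace_fin,
    show (Real.pi : ℂ) / (1 / 2) = ((2 * Real.pi : ℝ) : ℂ) by push_cast; ring]
  rw [show ((d : ℂ) / 2) = (((d : ℝ) / 2 : ℝ) : ℂ) by push_cast; ring,
    ← Complex.ofReal_cpow (by positivity), ← mul_assoc, ← Complex.ofReal_mul,
    inv_mul_cancel₀ (by positivity), Complex.ofReal_one, one_mul, Complex.I_sq]
  congr 1
  ring

lemma density_pos {h : ℝ} (hh : 0 < h) (ξ : Space d) : 0 < density h ξ := by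
  unfold density; positivity

lemma measurable_density (h : ℝ) : Measurable (density h : Space d → ℝ) := by
  unfold density; fun_prop

/-- The factor is the Jacobian of `ξ ↦ √(2h) ξ`: `gaussianWeight` is a density in the variable `ξ`,
`density` one in the position. -/
lemma gaussianWeight_eq {h : ℝ} (hh : 0 < h) (ξ : Space d) :
    gaussianWeight d ξ = Real.sqrt (2 * h) ^ d * density h ξ := by
  unfold gaussianWeight density
  have h0 : (2 * h) ^ ((d : ℝ) / 2) ≠ 0 := by positivity
  have h1 : Real.sqrt (2 * h) ^ d = (2 * h) ^ ((d : ℝ) / 2) := by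
    rw [Real.sqrt_eq_rpow, ← Real.rpow_natCast, ← Real.rpow_mul (by positivity)]
    congr 1
    ring
  have h2 : (4 * Real.pi * h) ^ ((d : ℝ) / 2) =
      (2 * Real.pi) ^ ((d : ℝ) / 2) * (2 * h) ^ ((d : ℝ) / 2) := by
    rw [← Real.mul_rpow (by positivity) (by positivity)]
    ring_nf
  rw [h1, h2, show -(1 / 2) * ‖ξ‖ ^ 2 = -‖ξ‖ ^ 2 / 2 by ring]
  generalize (2 * h) ^ ((d : ℝ) / 2) = a at h0
  field_simp

/-- Importance sampling: weighting a Gaussian particle by the inverse of its density turns its law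
into Lebesgue measure. -/
lemma measurePreserving_importance {h : ℝ} (hh : 0 < h) (w : Space d) :
    MeasurePreserving (fun ξ => w + Real.sqrt (2 * h) • ξ)
      ((stdGaussian (Space d)).withDensity fun ξ => ENNReal.ofReal (1 / density h ξ)) volume := by
  have hc : 0 < Real.sqrt (2 * h) := Real.sqrt_pos.2 (by positivity)
  have h1 : (stdGaussian (Space d)).withDensity (fun ξ => ENNReal.ofReal (1 / density h ξ)) =
      ENNReal.ofReal (Real.sqrt (2 * h) ^ d) • volume := by
    rw [stdGaussian_eq_withDensity, ← withDensity_mul _ measurable_gaussianWeight.ennreal_ofReal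
      ((measurable_density h).const_div 1).ennreal_ofReal, ← withDensity_const]
    congr 1
    ext ξ
    rw [Pi.mul_apply, ← ENNReal.ofReal_mul (gaussianWeight_nonneg ξ), gaussianWeight_eq hh]
    have := density_pos hh ξ
    congr 1
    field_simp
  refine ⟨by fun_prop, ?_⟩
  rw [h1, Measure.map_smul]
  have h2 : (fun ξ : Space d => w + Real.sqrt (2 * h) • ξ) =
      (fun y => w + y) ∘ fun ξ => Real.sqrt (2 * h) • ξ := rfl
  rw [h2, ← Measure.map_map (by fun_prop) (by fun_prop), Measure.map_addHaar_smul _ hc.ne',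
    Measure.map_smul, map_add_left_eq_self, smul_smul, finrank_euclideanSpace_fin,
    ← ENNReal.ofReal_mul (by positivity), abs_of_pos (by positivity),
    mul_inv_cancel₀ (by positivity), ENNReal.ofReal_one, one_smul]

lemma lintegral_importance {h : ℝ} (hh : 0 < h) (w : Space d) {Φ : Space d → ENNReal}
    (hΦ : Measurable Φ) :
    ∫⁻ ξ, ENNReal.ofReal (1 / density h ξ) * Φ (w + Real.sqrt (2 * h) • ξ) ∂stdGaussian (Space d) =
      ∫⁻ y, Φ y := by
  rw [← (measurePreserving_importance hh w).lintegral_comp hΦ,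
    lintegral_withDensity_eq_lintegral_mul _ ((measurable_density h).const_div 1).ennreal_ofReal
      (g := fun ξ => Φ (w + Real.sqrt (2 * h) • ξ)) (hΦ.comp (by fun_prop))]
  rfl

lemma integral_importance {E : Type*} [NormedAddCommGroup E] [NormedSpace ℝ E] {h : ℝ}
    (hh : 0 < h) (w : Space d) {Φ : Space d → E} (hΦ : AEStronglyMeasurable Φ volume) :
    ∫ ξ, (1 / density h ξ) • Φ (w + Real.sqrt (2 * h) • ξ) ∂stdGaussian (Space d) = ∫ y, Φ y := by
  have hm := measurePreserving_importance hh w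
  rw [← hm.map_eq] at hΦ ⊢
  rw [integral_map hm.measurable.aemeasurable hΦ, integral_withDensity_eq_integral_toReal_smul
    ((measurable_density h).const_div 1).ennreal_ofReal
    (Filter.Eventually.of_forall fun _ => ENNReal.ofReal_lt_top)]
  refine integral_congr_ae (Filter.Eventually.of_forall fun ξ => ?_)
  simp only
  rw [ENNReal.toReal_ofReal (one_div_nonneg.2 (density_pos hh ξ).le)]

/-- Used with `θ = 1/10`, where it yields the factor `(5/4)^(d/2)` of the sampling noise. -/
lemma lintegral_exp_sq_norm_stdGaussian {θ : ℝ} (hθ : θ < 1 / 2) :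
    ∫⁻ ξ, ENNReal.ofReal (Real.exp (θ * ‖ξ‖ ^ 2)) ∂stdGaussian (Space d) =
      ENNReal.ofReal ((1 / (1 - 2 * θ)) ^ ((d : ℝ) / 2)) := by
  have hb : 0 < 1 / 2 - θ := by linarith
  rw [stdGaussian_eq_withDensity, lintegral_withDensity_eq_lintegral_mul _
    measurable_gaussianWeight.ennreal_ofReal (by fun_prop)]
  have e : ∀ x : Space d, ((fun x : Space d => ENNReal.ofReal (gaussianWeight d x)) *
      fun x : Space d => ENNReal.ofReal (Real.exp (θ * ‖x‖ ^ 2))) x =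
      ENNReal.ofReal ((2 * Real.pi) ^ ((d : ℝ) / 2))⁻¹ *
        ENNReal.ofReal (Real.exp (-(1 / 2 - θ) * ‖x‖ ^ 2)) := by
    intro x
    rw [Pi.mul_apply, ← ENNReal.ofReal_mul (gaussianWeight_nonneg x),
      ← ENNReal.ofReal_mul (by positivity), gaussianWeight, mul_assoc, ← Real.exp_add]
    ring_nf
  simp_rw [e]
  rw [lintegral_const_mul _ (by fun_prop), lintegral_exp_neg_mul_sq_norm hb,
    ← ENNReal.ofReal_mul (by positivity), ← Real.inv_rpow (by positivity),
    ← Real.mul_rpow (by positivity) (by positivity)]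
  congr 2
  have : 1 - 2 * θ ≠ 0 := by linarith
  field_simp

end GaussianDensity

/-! ### The gradient estimator and its bias -/

section Stencil

variable {d : ℕ} {L η : ℝ} {f : Space d → ℝ}

/-- Linear isometries preserve both the ball and Lebesgue measure. Sign flips and swaps of
coordinates then determine all the second moments below. -/
lemma setIntegral_closedBall_comp (T : Space d ≃ₗᵢ[ℝ] Space d) (F : Space d → ℝ) :
    ∫ v in Metric.closedBall (0 : Space d) η, F (T v) = ∫ v in Metric.closedBall 0 η, F v := by
  have h := T.measurePreserving.setIntegral_preimage_emb
    T.toHomeomorph.measurableEmbedding F (Metric.closedBall 0 η)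
  rw [← h]
  congr 2
  ext v
  simp

lemma integrableOn_closedBall_of_bound {E : Type*} [NormedAddCommGroup E] {F : Space d → E}
    (hF : AEStronglyMeasurable F volume) {C : ℝ}
    (hC : ∀ v ∈ Metric.closedBall (0 : Space d) η, ‖F v‖ ≤ C) :
    IntegrableOn F (Metric.closedBall 0 η) volume :=
  Measure.integrableOn_of_bounded measure_closedBall_lt_top.ne hF
    ((ae_restrict_iff' measurableSet_closedBall).2 (Filter.Eventually.of_forall hC))

lemma abs_coord_mul_div_le (v : Space d) (k l : Fin d) : |v k * v l / ‖v‖ ^ 2| ≤ 1 := by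
  rw [abs_div, abs_mul, abs_of_nonneg (sq_nonneg ‖v‖)]
  refine div_le_one_of_le₀ ?_ (sq_nonneg _)
  rw [sq]
  exact mul_le_mul (PiLp.norm_apply_le v k) (PiLp.norm_apply_le v l) (abs_nonneg _)
    (norm_nonneg _)

lemma integrableOn_coord_mul (η : ℝ) (k l : Fin d) :
    IntegrableOn (fun v : Space d => v k * v l / ‖v‖ ^ 2) (Metric.closedBall 0 η) volume :=
  integrableOn_closedBall_of_bound (Measurable.aestronglyMeasurable (by fun_prop))
    fun v _ => abs_coord_mul_div_le v k l

lemma setIntegral_coord_mul_of_ne {k l : Fin d} (hkl : k ≠ l) :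
    ∫ v in Metric.closedBall (0 : Space d) η, v k * v l / ‖v‖ ^ 2 = 0 := by
  classical
  let T : Space d ≃ₗᵢ[ℝ] Space d := LinearIsometryEquiv.piLpCongrRight 2
    fun i => if i = k then LinearIsometryEquiv.neg ℝ else LinearIsometryEquiv.refl ℝ ℝ
  have h := setIntegral_closedBall_comp (η := η) T fun v => v k * v l / ‖v‖ ^ 2
  have hk : ∀ v, T v k = -v k := fun v => by simp [T]
  have hl : ∀ v, T v l = v l := fun v => by simp [T, hkl.symm]
  simp only [hk, hl, T.norm_map, neg_mul, neg_div] at h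
  rw [integral_neg] at h
  linarith

lemma setIntegral_coord_sq_eq (k l : Fin d) :
    ∫ v in Metric.closedBall (0 : Space d) η, v k * v k / ‖v‖ ^ 2 =
      ∫ v in Metric.closedBall (0 : Space d) η, v l * v l / ‖v‖ ^ 2 := by
  classical
  have h := setIntegral_closedBall_comp (η := η)
    (LinearIsometryEquiv.piLpCongrLeft 2 ℝ ℝ (Equiv.swap k l)) fun v => v k * v k / ‖v‖ ^ 2
  rw [← h]
  refine integral_congr_ae (Filter.Eventually.of_forall fun v => ?_)
  simp [LinearIsometryEquiv.piLpCongrLeft_apply]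

lemma setIntegral_coord_sq (hd : 0 < d) (k : Fin d) :
    ∫ v in Metric.closedBall (0 : Space d) η, v k * v k / ‖v‖ ^ 2 =
      (volume : Measure (Space d)).real (Metric.closedBall 0 η) / d := by
  have h1 : ∫ v in Metric.closedBall (0 : Space d) η, ∑ l, v l * v l / ‖v‖ ^ 2 =
      (volume : Measure (Space d)).real (Metric.closedBall 0 η) := by
    have : Nonempty (Fin d) := ⟨k⟩
    -- The quotients sum to `1` only off the origin, where division by zero makes them vanish; the
    -- origin is a null set.
    have hae : ∀ᵐ v ∂(volume.restrict (Metric.closedBall (0 : Space d) η)),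
        ∑ l, v l * v l / ‖v‖ ^ 2 = 1 := by
      refine ae_restrict_of_ae ?_
      filter_upwards [Measure.ae_ne volume (0 : Space d)] with v hv
      rw [← Finset.sum_div, EuclideanSpace.real_norm_sq_eq]
      simp_rw [← sq]
      refine div_self ?_
      rw [← EuclideanSpace.real_norm_sq_eq]
      exact pow_ne_zero _ (norm_ne_zero_iff.2 hv)
    rw [integral_congr_ae hae]
    simp
  rw [integral_finsetSum _ fun l _ => integrableOn_coord_mul η l l] at h1
  simp_rw [setIntegral_coord_sq_eq _ k] at h1
  rw [Finset.sum_const, Finset.card_univ, Fintype.card_fin, nsmul_eq_mul] at h1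
  rw [← h1]
  have : (d : ℝ) ≠ 0 := by positivity
  field_simp

lemma volume_real_closedBall_pos (hη : 0 < η) :
    0 < (volume : Measure (Space d)).real (Metric.closedBall 0 η) :=
  ENNReal.toReal_pos (Metric.measure_closedBall_pos _ _ hη).ne' measure_closedBall_lt_top.ne

lemma alpha_nonneg (d : ℕ) (η : ℝ) : 0 ≤ alpha d η := by unfold alpha; positivity

/-- The radial singularity of the finite-difference direction is harmless. -/
lemma norm_dir_le {a c B : ℝ} (hc : 0 ≤ c) (hB : 0 ≤ B) {v : Space d} (ha : |a| ≤ B * ‖v‖) :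
    ‖(c * (a / ‖v‖ ^ 2)) • v‖ ≤ c * B := by
  rw [norm_smul, Real.norm_eq_abs, abs_mul, abs_div, abs_of_nonneg hc,
    abs_of_nonneg (sq_nonneg ‖v‖), mul_assoc]
  refine mul_le_mul_of_nonneg_left ?_ hc
  rcases (norm_nonneg v).eq_or_lt with h | h
  · simp [← h, hB]
  · rw [div_mul_eq_mul_div, div_le_iff₀ (by positivity)]
    nlinarith

lemma integrableOn_alpha_inner (g : Space d) :
    IntegrableOn (fun v : Space d => (alpha d η * (⟪g, v⟫ / ‖v‖ ^ 2)) • v)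
      (Metric.closedBall 0 η) volume :=
  integrableOn_closedBall_of_bound (Measurable.aestronglyMeasurable (by fun_prop))
    fun v _ => norm_dir_le (alpha_nonneg d η) (norm_nonneg g) (abs_real_inner_le_norm g v)

/-- The spherical average of `⟨g, v⟩ v / |v|²`, with the normalization `α_d`, is `g`. -/
lemma setIntegral_alpha_inner (hd : 0 < d) (hη : 0 < η) (g : Space d) :
    ∫ v in Metric.closedBall (0 : Space d) η, (alpha d η * (⟪g, v⟫ / ‖v‖ ^ 2)) • v = g := by
  have hint := integrableOn_alpha_inner (η := η) g
  ext k
  have h1 := (EuclideanSpace.proj k : Space d →L[ℝ] ℝ).integral_comp_comm hint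
  refine h1.symm.trans ?_
  change ∫ v in Metric.closedBall (0 : Space d) η,
    ((alpha d η * (⟪g, v⟫ / ‖v‖ ^ 2)) • v) k = g k
  have e : ∀ v : Space d, ((alpha d η * (⟪g, v⟫ / ‖v‖ ^ 2)) • v) k =
      ∑ l, alpha d η * g l * (v k * v l / ‖v‖ ^ 2) := by
    intro v
    rw [PiLp.smul_apply, PiLp.inner_apply, Finset.sum_div, Finset.mul_sum, smul_eq_mul,
      Finset.sum_mul]
    refine Finset.sum_congr rfl fun l _ => ?_
    simp
    ring
  simp_rw [e]
  rw [integral_finsetSum _ fun l _ => (integrableOn_coord_mul η k l).const_mul _,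
    Finset.sum_eq_single k]
  · rw [integral_const_mul, setIntegral_coord_sq hd, alpha]
    have := volume_real_closedBall_pos (d := d) hη
    field_simp
  · intro l _ hl
    rw [integral_const_mul, setIntegral_coord_mul_of_ne hl.symm, mul_zero]
  · simp

open Classical in
/-- The integrand of the gradient estimator at `x`, as a function of the sampled position `y`. -/
def stencil (f : Space d → ℝ) (η : ℝ) (x y : Space d) : Space d :=
  if ‖y - x‖ ≤ η then (alpha d η * ((f y - f x) / ‖y - x‖ ^ 2)) • (y - x) else 0

lemma measurable_stencil (hf : Measurable f) (x : Space d) : Measurable (stencil f η x) := by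
  unfold stencil
  exact Measurable.ite (measurableSet_le (by fun_prop) (by fun_prop)) (by fun_prop) (by fun_prop)

lemma LSmooth.abs_sub_le (hL : 0 < L) (hf : LSmooth L f) {x y : Space d} (hxy : ‖y - x‖ ≤ η) :
    |f y - f x| ≤ (‖gradient f x‖ + L * η / 2) * ‖y - x‖ := by
  have h1 := hf.abs_sub_le_quadratic x y
  have h2 := abs_real_inner_le_norm (gradient f x) (y - x)
  have h3 : |f y - f x| ≤ |f y - f x - ⟪gradient f x, y - x⟫| + |⟪gradient f x, y - x⟫| := by
    simpa using abs_add_le (f y - f x - ⟪gradient f x, y - x⟫) ⟪gradient f x, y - x⟫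
  have h4 : L / 2 * ‖y - x‖ ^ 2 ≤ L / 2 * (η * ‖y - x‖) := by
    rw [sq]; gcongr
  nlinarith

lemma norm_stencil_le (hL : 0 < L) (hη : 0 < η) (hf : LSmooth L f) (x y : Space d) :
    ‖stencil f η x y‖ ≤ alpha d η * (‖gradient f x‖ + L * η / 2) := by
  have hB : 0 ≤ ‖gradient f x‖ + L * η / 2 := by positivity
  unfold stencil
  split_ifs with h
  · exact norm_dir_le (alpha_nonneg d η) hB (hf.abs_sub_le hL h)
  · rw [norm_zero]
    exact mul_nonneg (alpha_nonneg d η) hB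

/-- The gradient estimator is biased by at most `d L η / 2`. -/
lemma norm_integral_stencil_sub_le (hd : 0 < d) (hL : 0 < L) (hη : 0 < η) (hf : LSmooth L f)
    (x : Space d) : ‖(∫ y, stencil f η x y) - gradient f x‖ ≤ d * L * η / 2 := by
  have h0 : ∫ y, stencil f η x y = ∫ v in Metric.closedBall (0 : Space d) η,
      (alpha d η * ((f (v + x) - f x) / ‖v‖ ^ 2)) • v := by
    rw [← integral_add_right_eq_self _ x, ← integral_indicator measurableSet_closedBall]
    refine integral_congr_ae (Filter.Eventually.of_forall fun v => ?_)
    simp [stencil, Set.indicator]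
  have hfm : Measurable f := hf.1.continuous.measurable
  have hi1 : IntegrableOn (fun v : Space d => (alpha d η * ((f (v + x) - f x) / ‖v‖ ^ 2)) • v)
      (Metric.closedBall 0 η) volume := by
    have hB : 0 ≤ ‖gradient f x‖ + L * η / 2 := by positivity
    have hm : Measurable fun v : Space d => (alpha d η * ((f (v + x) - f x) / ‖v‖ ^ 2)) • v := by
      fun_prop
    refine integrableOn_closedBall_of_bound hm.aestronglyMeasurable
      (C := alpha d η * (‖gradient f x‖ + L * η / 2))
      fun v hv => norm_dir_le (alpha_nonneg d η) hB ?_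
    rw [mem_closedBall_zero_iff] at hv
    have := hf.abs_sub_le (η := η) (x := x) (y := v + x) hL (by rwa [add_sub_cancel_right])
    rwa [add_sub_cancel_right] at this
  have hi2 := integrableOn_alpha_inner (η := η) (gradient f x)
  rw [h0]
  -- With `∇f(x)` written as the ball integral of the linearization, the bias becomes the integral
  -- of the Taylor remainder, at most `(Lη/2)|v|`. The singularity costs nothing, and `α_d V = d`.
  conv_lhs => rw [← setIntegral_alpha_inner hd hη (gradient f x)]
  rw [← integral_sub hi1 hi2]
  have hb : ∀ v ∈ Metric.closedBall (0 : Space d) η,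
      ‖(alpha d η * ((f (v + x) - f x) / ‖v‖ ^ 2)) • v -
        (alpha d η * (⟪gradient f x, v⟫ / ‖v‖ ^ 2)) • v‖ ≤ alpha d η * (L * η / 2) := by
    intro v hv
    rw [mem_closedBall_zero_iff] at hv
    rw [← sub_smul, ← mul_sub, ← sub_div]
    refine norm_dir_le (alpha_nonneg d η) (by positivity) ?_
    have := hf.abs_sub_le_quadratic x (v + x)
    rw [add_sub_cancel_right] at this
    refine this.trans ?_
    rw [sq, ← mul_assoc]
    gcongr
    linarith [mul_le_mul_of_nonneg_left hv hL.le]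
  refine (norm_setIntegral_le_of_norm_le_const measure_closedBall_lt_top hb).trans (le_of_eq ?_)
  have := volume_real_closedBall_pos (d := d) hη
  rw [alpha]
  field_simp

end Stencil

/-! ### Independent samples -/

section ProductMeasure

variable {d N : ℕ}

/-- The variance of a sum of independent random vectors with a common mean. -/
lemma integral_norm_sum_sub_sq_le (γ : Measure (Space d)) [IsProbabilityMeasure γ]
    (S : Finset (Fin N)) {Y : Fin N → Space d → Space d} (hm : ∀ j, Measurable (Y j)) {C : ℝ}
    (hC : ∀ j ∈ S, ∀ y, ‖Y j y‖ ≤ C) {b : Space d} (hb : ∀ j ∈ S, ∫ y, Y j y ∂γ = b) :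
    ∫ ξ, ‖∑ j ∈ S, (Y j (ξ j) - b)‖ ^ 2 ∂Measure.pi (fun _ : Fin N => γ) ≤
      ∑ j ∈ S, ∫ y, ‖Y j y‖ ^ 2 ∂γ := by
  set P := Measure.pi (fun _ : Fin N => γ)
  -- Variance is a notion for real variables, so the estimate is made coordinatewise and summed over
  -- `k`.
  let X : Fin d → Fin N → (Fin N → Space d) → ℝ := fun k j ξ => Y j (ξ j) k
  have hmp : ∀ j, MeasurePreserving (fun ξ : Fin N → Space d => ξ j) P γ := fun j =>
    measurePreserving_eval (fun _ : Fin N => γ) j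
  have hYm : ∀ j, Measurable fun ξ : Fin N → Space d => Y j (ξ j) := fun j =>
    (hm j).comp (measurable_pi_apply j)
  have hXm : ∀ k j, Measurable (X k j) := fun k j =>
    (show Measurable fun v : Space d => v k by fun_prop).comp (hYm j)
  have hXb : ∀ k, ∀ j ∈ S, ∀ ξ, ‖X k j ξ‖ ≤ C := fun k j hj ξ =>
    (PiLp.norm_apply_le (Y j (ξ j)) k).trans (hC j hj _)
  have hX2 : ∀ k, ∀ j ∈ S, MemLp (X k j) 2 P := fun k j hj =>
    MemLp.of_bound (hXm k j).aestronglyMeasurable C (Filter.Eventually.of_forall (hXb k j hj))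
  have hYint : ∀ j ∈ S, Integrable (Y j) γ := fun j hj =>
    Integrable.of_bound (hm j).aestronglyMeasurable C (Filter.Eventually.of_forall (hC j hj))
  have hmean : ∀ k, ∀ j ∈ S, ∫ ξ, X k j ξ ∂P = b k := by
    intro k j hj
    have h1 : ∫ ξ, X k j ξ ∂P = ∫ y, Y j y k ∂γ := by
      rw [← (hmp j).map_eq, integral_map (hmp j).measurable.aemeasurable]
      exact Measurable.aestronglyMeasurable
        ((show Measurable fun v : Space d => v k by fun_prop).comp (hm j))
    rw [h1, ← hb j hj]
    exact (EuclideanSpace.proj k : Space d →L[ℝ] ℝ).integral_comp_comm (hYint j hj)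
  have hind : ∀ k, iIndepFun (X k) P := fun k =>
    iIndepFun_pi (μ := fun _ : Fin N => γ) (X := fun j y => Y j y k) fun j =>
      ((show Measurable fun v : Space d => v k by fun_prop).comp (hm j)).aemeasurable
  have hvar : ∀ k, ∫ ξ, (∑ j ∈ S, (X k j ξ - b k)) ^ 2 ∂P ≤ ∑ j ∈ S, ∫ ξ, X k j ξ ^ 2 ∂P := by
    intro k
    have h1 := IndepFun.variance_sum (hX2 k) fun i _ j _ hij => (hind k).indepFun hij
    have h2 : Var[∑ j ∈ S, X k j; P] = ∫ ξ, (∑ j ∈ S, (X k j ξ - b k)) ^ 2 ∂P := by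
      rw [variance_eq_integral (Finset.aemeasurable_sum _ fun j _ => (hXm k j).aemeasurable)]
      have : ∫ ξ, (∑ j ∈ S, X k j) ξ ∂P = ∑ j ∈ S, b k := by
        simp_rw [Finset.sum_apply]
        rw [integral_finsetSum _ fun j hj => (hX2 k j hj).integrable one_le_two]
        exact Finset.sum_congr rfl fun j hj => hmean k j hj
      simp_rw [this, Finset.sum_apply, Finset.sum_sub_distrib]
    rw [← h2, h1]
    exact Finset.sum_le_sum fun j hj => variance_le_expectation_sq (hXm k j).aestronglyMeasurable
  have hint : ∀ k, Integrable (fun ξ => (∑ j ∈ S, (X k j ξ - b k)) ^ 2) P := fun k =>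
    (memLp_finsetSum S fun j hj => (hX2 k j hj).sub (memLp_const (b k))).integrable_sq
  calc ∫ ξ, ‖∑ j ∈ S, (Y j (ξ j) - b)‖ ^ 2 ∂P
      = ∫ ξ, ∑ k, (∑ j ∈ S, (X k j ξ - b k)) ^ 2 ∂P := by
        congr 1
        ext ξ
        rw [EuclideanSpace.real_norm_sq_eq]
        simp [X]
    _ = ∑ k, ∫ ξ, (∑ j ∈ S, (X k j ξ - b k)) ^ 2 ∂P := integral_finsetSum _ fun k _ => hint k
    _ ≤ ∑ k, ∑ j ∈ S, ∫ ξ, X k j ξ ^ 2 ∂P := Finset.sum_le_sum fun k _ => hvar k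
    _ = ∑ j ∈ S, ∑ k, ∫ ξ, X k j ξ ^ 2 ∂P := Finset.sum_comm
    _ = ∑ j ∈ S, ∫ y, ‖Y j y‖ ^ 2 ∂γ := by
        refine Finset.sum_congr rfl fun j hj => ?_
        rw [← integral_finsetSum _ fun k _ => (hX2 k j hj).integrable_sq, ← (hmp j).map_eq,
          integral_map (hmp j).measurable.aemeasurable]
        · congr 1
          ext ξ
          rw [EuclideanSpace.real_norm_sq_eq]
        · exact ((hm j).norm.pow_const 2).aestronglyMeasurable

/-- Resampling one coordinate of a product measure. -/
lemma measurePreserving_update (γ : Measure (Space d)) [IsProbabilityMeasure γ] (i : Fin N) :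
    MeasurePreserving (fun q : Space d × (Fin N → Space d) => Function.update q.2 i q.1)
      (γ.prod (Measure.pi fun _ => γ)) (Measure.pi fun _ => γ) := by
  have hmeas : Measurable fun q : Space d × (Fin N → Space d) => Function.update q.2 i q.1 := by
    refine measurable_pi_lambda _ fun j => ?_
    by_cases hj : j = i
    · subst hj
      simpa using measurable_fst
    · simp only [Function.update_of_ne hj]
      exact (measurable_pi_apply j).comp measurable_snd
  refine ⟨hmeas, (Measure.pi_eq fun s hs => ?_).symm⟩
  have hpre : (fun q : Space d × (Fin N → Space d) => Function.update q.2 i q.1) ⁻¹'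
      Set.univ.pi s = s i ×ˢ Set.univ.pi (Function.update s i Set.univ) := by
    ext ⟨a, ξ⟩
    simp only [Set.mem_preimage, Set.mem_pi, Set.mem_univ, true_implies, Set.mem_prod]
    constructor
    · intro h
      refine ⟨by simpa using h i, fun j => ?_⟩
      by_cases hj : j = i
      · subst hj; simp
      · simpa [hj] using h j
    · rintro ⟨h1, h2⟩ j
      by_cases hj : j = i
      · subst hj; simpa using h1
      · simpa [hj] using h2 j
  rw [Measure.map_apply hmeas (MeasurableSet.univ_pi hs), hpre, Measure.prod_prod, Measure.pi_pi,
    ← Finset.mul_prod_erase _ _ (Finset.mem_univ i), Function.update_self, measure_univ, one_mul,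
    ← Finset.mul_prod_erase _ (fun j => γ (s j)) (Finset.mem_univ i)]
  congr 1
  refine Finset.prod_congr rfl fun j hj => ?_
  rw [Function.update_of_ne (Finset.ne_of_mem_erase hj)]

end ProductMeasure

/-! ### Sampling error of the ensemble average -/

section Sampling

variable {d N : ℕ} {L : ℝ} {f : Space d → ℝ}

section Measurability

variable {α : Type*} [MeasurableSpace α] {X W Ξ : α → Fin N → Space d}

lemma measurable_neighbors (p : Params) (hW : Measurable W) (i : Fin N) :
    Measurable fun a => (neighbors p (W a) i : ℝ) := by
  classical
  have hWj : ∀ j, Measurable fun a => W a j := fun j => (measurable_pi_apply j).comp hW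
  unfold neighbors
  simp_rw [Finset.card_filter, Nat.cast_sum, Nat.cast_ite]
  refine Finset.measurable_sum _ fun j _ => Measurable.ite ?_ measurable_const measurable_const
  exact (MeasurableSet.const _).inter
    (measurableSet_le ((hWj j).sub (hWj i)).norm measurable_const)

lemma measurable_pairForce (p : Params) (hf : Measurable f) (hX : Measurable X)
    (hW : Measurable W) (hΞ : Measurable Ξ) (i j : Fin N) :
    Measurable fun a => pairForce p f (X a) (W a) (Ξ a) i j := by
  classical
  have hXj : ∀ j, Measurable fun a => X a j := fun j => (measurable_pi_apply j).comp hX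
  have hWj : ∀ j, Measurable fun a => W a j := fun j => (measurable_pi_apply j).comp hW
  have hΞj : ∀ j, Measurable fun a => Ξ a j := fun j => (measurable_pi_apply j).comp hΞ
  unfold pairForce
  refine Measurable.ite ?_ ?_ measurable_const
  · exact (measurableSet_le ((hXj j).sub (hXj i)).norm measurable_const).inter
      (measurableSet_le ((hWj j).sub (hWj i)).norm measurable_const)
  · have h1 : Measurable fun a => (f (X a j) - f (X a i)) / ‖X a j - X a i‖ ^ 2 :=
      ((hf.comp (hXj j)).sub (hf.comp (hXj i))).div (((hXj j).sub (hXj i)).norm.pow_const 2)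
    have h2 : Measurable fun a => density p.h (Ξ a j) := (measurable_density p.h).comp (hΞj j)
    exact ((h1.const_mul _).div h2).smul ((hXj j).sub (hXj i))

lemma measurable_force (p : Params) (hf : Measurable f) (hg : Measurable (gradient f))
    (hX : Measurable X) (hW : Measurable W) (hΞ : Measurable Ξ) (i : Fin N) :
    Measurable fun a => force p f (X a) (W a) (Ξ a) i := by
  classical
  have hXj : ∀ j, Measurable fun a => X a j := fun j => (measurable_pi_apply j).comp hX
  have hΞj : ∀ j, Measurable fun a => Ξ a j := fun j => (measurable_pi_apply j).comp hΞ
  have hn := measurable_neighbors p hW i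
  unfold force
  refine Measurable.ite ?_ (hg.comp (hXj i)) ?_
  · exact (measurableSet_lt measurable_const ((hΞj i).norm.const_mul _)).union
      ((measurableSet_lt measurable_const (hf.comp (hXj i))).union
        (measurableSet_lt hn measurable_const))
  · exact (hn.const_div 1).smul
      (Finset.measurable_sum _ fun j _ => measurable_pairForce p hf hX hW hΞ i j)

end Measurability

/-- The gradient estimate at `x` from a single particle with Gaussian increment `b` around `v`. -/
def sample (f : Space d → ℝ) (h η : ℝ) (x v b : Space d) : Space d :=
  (1 / density h b) • stencil f η x (v + Real.sqrt (2 * h) • b)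

lemma measurable_sample (hf : Measurable f) (h η : ℝ) (x v : Space d) :
    Measurable (sample f h η x v) := by
  unfold sample
  exact ((measurable_density h).const_div 1).smul ((measurable_stencil hf x).comp (by fun_prop))

/-- The largest inverse density that contributes to the estimate at distance `s` from the mean. -/
def inverseDensityBound (d : ℕ) (h η R s : ℝ) : ℝ :=
  (4 * Real.pi * h) ^ ((d : ℝ) / 2) * Real.exp ((s + R + η) ^ 2 / (4 * h))

lemma inverseDensityBound_pos {h η R s : ℝ} (hh : 0 < h) : 0 < inverseDensityBound d h η R s := by
  unfold inverseDensityBound; positivity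

/-- By the triangle inequality `√(2h)|b| ≤ √(2h)|a| + R + η`, and the inverse density increases with
`|b|`. -/
lemma one_div_density_le {h η R : ℝ} (hh : 0 < h) {u v a b : Space d} (huv : ‖v - u‖ ≤ R)
    (hb : ‖v + Real.sqrt (2 * h) • b - (u + Real.sqrt (2 * h) • a)‖ ≤ η) :
    1 / density h b ≤ inverseDensityBound d h η R (Real.sqrt (2 * h) * ‖a‖) := by
  set c := Real.sqrt (2 * h) with hc
  have hc0 : 0 ≤ c := Real.sqrt_nonneg _
  have hc2 : c ^ 2 = 2 * h := Real.sq_sqrt (by positivity)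
  have h1 : c * ‖b‖ ≤ c * ‖a‖ + R + η := by
    calc c * ‖b‖ = ‖(v + c • b - (u + c • a)) + c • a - (v - u)‖ := by
          rw [show (v + c • b - (u + c • a)) + c • a - (v - u) = c • b by abel, norm_smul,
            Real.norm_of_nonneg hc0]
      _ ≤ ‖v + c • b - (u + c • a)‖ + ‖c • a‖ + ‖v - u‖ :=
          (norm_sub_le _ _).trans (by gcongr; exact norm_add_le _ _)
      _ ≤ η + c * ‖a‖ + R := by
          rw [norm_smul, Real.norm_of_nonneg hc0]; gcongr
      _ = _ := by ring
  have h2 : ‖b‖ ^ 2 / 2 ≤ (c * ‖a‖ + R + η) ^ 2 / (4 * h) := by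
    rw [le_div_iff₀ (by positivity)]
    have := pow_le_pow_left₀ (by positivity) h1 2
    rw [mul_pow, hc2] at this
    linarith
  unfold density inverseDensityBound
  rw [one_div_mul_eq_div, one_div_div, div_eq_mul_inv, ← Real.exp_neg]
  gcongr
  linarith

section Sample

variable {h η R : ℝ} {u v a : Space d}

lemma norm_sample_le (hh : 0 < h) (hL : 0 < L) (hη : 0 < η) (hf : LSmooth L f)
    (huv : ‖v - u‖ ≤ R) (b : Space d) :
    ‖sample f h η (u + Real.sqrt (2 * h) • a) v b‖ ≤
      inverseDensityBound d h η R (Real.sqrt (2 * h) * ‖a‖) *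
        (alpha d η * (‖gradient f (u + Real.sqrt (2 * h) • a)‖ + L * η / 2)) := by
  have hK := inverseDensityBound_pos (d := d) (η := η) (R := R) (s := Real.sqrt (2 * h) * ‖a‖) hh
  by_cases hb : ‖v + Real.sqrt (2 * h) • b - (u + Real.sqrt (2 * h) • a)‖ ≤ η
  · rw [sample, norm_smul, Real.norm_of_nonneg (one_div_nonneg.2 (density_pos hh b).le)]
    exact mul_le_mul (one_div_density_le hh huv hb) (norm_stencil_le hL hη hf _ _)
      (norm_nonneg _) hK.le
  · rw [sample, stencil, if_neg hb, smul_zero, norm_zero]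
    have := alpha_nonneg d η
    positivity

lemma integral_sample (hh : 0 < h) (hf : Measurable f) (x v : Space d) :
    ∫ b, sample f h η x v b ∂stdGaussian (Space d) = ∫ y, stencil f η x y :=
  integral_importance hh v (measurable_stencil hf x).aestronglyMeasurable

/-- Of the two inverse densities in the square, one is bounded by its maximum and the other turns
the Gaussian into Lebesgue measure on the `η`-ball. Hence the bound is linear in
`inverseDensityBound`. -/
lemma integral_norm_sample_sq_le (hh : 0 < h) (hL : 0 < L) (hη : 0 < η) (hf : LSmooth L f)
    (huv : ‖v - u‖ ≤ R) :
    ∫ b, ‖sample f h η (u + Real.sqrt (2 * h) • a) v b‖ ^ 2 ∂stdGaussian (Space d) ≤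
      inverseDensityBound d h η R (Real.sqrt (2 * h) * ‖a‖) *
        (alpha d η * (‖gradient f (u + Real.sqrt (2 * h) • a)‖ + L * η / 2)) ^ 2 *
          (volume : Measure (Space d)).real (Metric.closedBall 0 η) := by
  set x := u + Real.sqrt (2 * h) • a with hx
  set K := inverseDensityBound d h η R (Real.sqrt (2 * h) * ‖a‖) with hKdef
  have hK : 0 < K := inverseDensityBound_pos hh
  set B := alpha d η * (‖gradient f x‖ + L * η / 2) with hB
  let I : Space d → ℝ := (Metric.closedBall x η).indicator fun _ => 1
  have hI : ∫ b, (1 / density h b) • I (v + Real.sqrt (2 * h) • b) ∂stdGaussian (Space d) =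
      (volume : Measure (Space d)).real (Metric.closedBall 0 η) := by
    rw [integral_importance hh v (measurable_const.indicator
      measurableSet_closedBall).aestronglyMeasurable, integral_indicator_const _
      measurableSet_closedBall, smul_eq_mul, mul_one, Measure.real, Measure.real,
      Measure.addHaar_closedBall_center]
  have hint : Integrable (fun b => (1 / density h b) • I (v + Real.sqrt (2 * h) • b))
      (stdGaussian (Space d)) :=
    Integrable.of_integral_ne_zero (by rw [hI]; exact (volume_real_closedBall_pos hη).ne')
  rw [← hI, ← integral_const_mul]
  refine integral_mono_of_nonneg (Filter.Eventually.of_forall fun b => sq_nonneg _)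
    (hint.const_mul _) (Filter.Eventually.of_forall fun b => ?_)
  have hρ := one_div_pos.2 (density_pos hh b)
  simp only
  by_cases hb : ‖v + Real.sqrt (2 * h) • b - x‖ ≤ η
  · have hbK : 1 / density h b ≤ K := one_div_density_le hh huv hb
    have h1 : I (v + Real.sqrt (2 * h) • b) = 1 :=
      Set.indicator_of_mem (mem_closedBall_iff_norm.2 hb) _
    have h2 := norm_stencil_le hL hη hf x (v + Real.sqrt (2 * h) • b)
    rw [h1, sample, norm_smul, Real.norm_of_nonneg hρ.le, smul_eq_mul, mul_one, mul_pow]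
    calc (1 / density h b) ^ 2 * ‖stencil f η x (v + Real.sqrt (2 * h) • b)‖ ^ 2
        ≤ (K * (1 / density h b)) * B ^ 2 := by
          rw [sq (1 / density h b)]
          gcongr
      _ = _ := by ring
  · rw [sample, stencil, if_neg hb, smul_zero, norm_zero, zero_pow two_ne_zero]
    have : 0 ≤ I (v + Real.sqrt (2 * h) • b) := Set.indicator_nonneg (fun _ _ => zero_le_one) _
    rw [smul_eq_mul]
    positivity

/-- The mean error of the ensemble average for a fixed position `x = u + √(2h) a`. -/
lemma lintegral_ensemble_average_le (hd : 0 < d) (hh : 0 < h) (hL : 0 < L) (hη : 0 < η)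
    (hf : LSmooth L f) {S : Finset (Fin N)} (hS : S.Nonempty) {w : Fin N → Space d}
    (hw : ∀ j ∈ S, ‖w j - u‖ ≤ R) {t : ℝ} (ht : 0 < t) :
    ∫⁻ ξ, ‖(1 / (S.card : ℝ)) • ∑ j ∈ S, sample f h η (u + Real.sqrt (2 * h) • a) (w j) (ξ j) -
        gradient f (u + Real.sqrt (2 * h) • a)‖ₑ
        ∂Measure.pi (fun _ : Fin N => stdGaussian (Space d)) ≤
      ENNReal.ofReal (d * L * η / 2 + (t + (inverseDensityBound d h η R (Real.sqrt (2 * h) * ‖a‖) *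
        (alpha d η * (‖gradient f (u + Real.sqrt (2 * h) • a)‖ + L * η / 2)) ^ 2 *
          (volume : Measure (Space d)).real (Metric.closedBall 0 η)) / S.card / t) / 2) := by
  set x := u + Real.sqrt (2 * h) • a with hx
  set P := Measure.pi (fun _ : Fin N => stdGaussian (Space d))
  set M := inverseDensityBound d h η R (Real.sqrt (2 * h) * ‖a‖) *
        (alpha d η * (‖gradient f x‖ + L * η / 2)) ^ 2 *
          (volume : Measure (Space d)).real (Metric.closedBall 0 η) with hM
  have hn : (0 : ℝ) < S.card := by exact_mod_cast hS.card_pos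
  set n : ℝ := (S.card : ℝ) with hndef
  have hfm : Measurable f := hf.1.continuous.measurable
  set b := ∫ y, stencil f η x y with hb
  let Z : (Fin N → Space d) → Space d := fun ξ => ∑ j ∈ S, (sample f h η x (w j) (ξ j) - b)
  have hZm : Measurable Z := Finset.measurable_sum _ fun j _ =>
    ((measurable_sample hfm h η x (w j)).comp (measurable_pi_apply j)).sub_const b
  obtain ⟨C, hC⟩ : ∃ C, ∀ j ∈ S, ∀ y, ‖sample f h η x (w j) y‖ ≤ C :=
    ⟨_, fun j hj y => norm_sample_le hh hL hη hf (hw j hj) y⟩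
  have hZb : ∀ ξ, ‖Z ξ‖ ≤ ∑ j ∈ S, (C + ‖b‖) := fun ξ =>
    (norm_sum_le _ _).trans (Finset.sum_le_sum fun j hj =>
      (norm_sub_le _ _).trans (by gcongr; exact hC j hj _))
  have hZ2 : Integrable (fun ξ => ‖Z ξ‖ ^ 2) P :=
    Integrable.of_bound (hZm.norm.pow_const 2).aestronglyMeasurable ((∑ j ∈ S, (C + ‖b‖)) ^ 2)
      (Filter.Eventually.of_forall fun ξ => by
        rw [Real.norm_of_nonneg (sq_nonneg _)]
        gcongr
        exact hZb ξ)
  have hvar : ∫ ξ, ‖Z ξ‖ ^ 2 ∂P ≤ n * M := by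
    refine (integral_norm_sum_sub_sq_le (stdGaussian (Space d)) S
      (fun j => measurable_sample hfm h η x (w j)) hC
      fun j _ => integral_sample hh hfm x (w j)).trans ?_
    calc ∑ j ∈ S, ∫ y, ‖sample f h η x (w j) y‖ ^ 2 ∂stdGaussian (Space d) ≤ ∑ j ∈ S, M :=
          Finset.sum_le_sum fun j hj => integral_norm_sample_sq_le hh hL hη hf (hw j hj)
      _ = n * M := by rw [Finset.sum_const, nsmul_eq_mul]
  -- The bias plus the inequality `|Z|/n ≤ t/2 + |Z|²/(2n²t)`. Keeping `t` free, instead of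
  -- optimizing it to a square root, allows a choice depending on `a` that can be integrated
  -- exactly.
  have hpt : ∀ ξ, ‖(1 / n) • ∑ j ∈ S, sample f h η x (w j) (ξ j) - gradient f x‖ ≤
      (d * L * η / 2 + t / 2) + (1 / (2 * n ^ 2 * t)) * ‖Z ξ‖ ^ 2 := by
    intro ξ
    have e : (1 / n) • ∑ j ∈ S, sample f h η x (w j) (ξ j) - gradient f x =
        (1 / n) • Z ξ + (b - gradient f x) := by
      simp only [Z]
      rw [Finset.sum_sub_distrib, Finset.sum_const, smul_sub, ← Nat.cast_smul_eq_nsmul ℝ,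
        smul_smul, ← hndef, one_div_mul_cancel hn.ne', one_smul]
      abel
    have h1 := norm_integral_stencil_sub_le hd hL hη hf x
    have h2 : ‖(1 / n) • Z ξ‖ ≤ t / 2 + (1 / (2 * n ^ 2 * t)) * ‖Z ξ‖ ^ 2 := by
      rw [norm_smul, Real.norm_of_nonneg (by positivity)]
      have h3 : t / 2 + (1 / (2 * n ^ 2 * t)) * ‖Z ξ‖ ^ 2 - 1 / n * ‖Z ξ‖ =
          (n * t - ‖Z ξ‖) ^ 2 / (2 * n ^ 2 * t) := by
        field_simp
        ring
      have h4 : 0 ≤ (n * t - ‖Z ξ‖) ^ 2 / (2 * n ^ 2 * t) := by positivity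
      linarith
    rw [e]
    refine (norm_add_le _ _).trans ?_
    linarith
  have hint : Integrable (fun ξ => (d * L * η / 2 + t / 2) + (1 / (2 * n ^ 2 * t)) * ‖Z ξ‖ ^ 2) P :=
    (integrable_const _).add (hZ2.const_mul _)
  calc ∫⁻ ξ, ‖(1 / n) • ∑ j ∈ S, sample f h η x (w j) (ξ j) - gradient f x‖ₑ ∂P
      ≤ ∫⁻ ξ, ENNReal.ofReal ((d * L * η / 2 + t / 2) + (1 / (2 * n ^ 2 * t)) * ‖Z ξ‖ ^ 2) ∂P :=
        lintegral_mono fun ξ => by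
          rw [← ofReal_norm]
          exact ENNReal.ofReal_le_ofReal (hpt ξ)
    _ = ENNReal.ofReal (∫ ξ, ((d * L * η / 2 + t / 2) + (1 / (2 * n ^ 2 * t)) * ‖Z ξ‖ ^ 2) ∂P) := by
        rw [ofReal_integral_eq_lintegral_ofReal hint]
        exact Filter.Eventually.of_forall fun ξ => by simp only [Pi.zero_apply]; positivity
    _ ≤ _ := by
        refine ENNReal.ofReal_le_ofReal ?_
        rw [integral_add (integrable_const _) (hZ2.const_mul _), integral_const,
          integral_const_mul, probReal_univ, one_smul]
        have h5 : 1 / (2 * n ^ 2 * t) * ∫ ξ, ‖Z ξ‖ ^ 2 ∂P ≤ 1 / (2 * n ^ 2 * t) * (n * M) := by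
          gcongr
        have h6 : 1 / (2 * n ^ 2 * t) * (n * M) = M / n / t / 2 := by
          field_simp
        linarith

end Sample

end Sampling

/-! ### Mean force error -/

section ForceError

variable {d N : ℕ} {L μ κ fstar ε ρ : ℝ} {f : Space d → ℝ} {p : Params}

open Classical in
-- The neighbour count depends on `w` only, and pairs farther apart than `R₂` contribute nothing.
-- Once the increment of particle `i` is fixed to `a`, the estimate is therefore an average of
-- independent samples over a fixed index set.
lemma force_update (p : Params) (f : Space d → ℝ) (w ξ : Fin N → Space d) (i : Fin N)
    (a : Space d) :
    force p f (fun j => w j + Real.sqrt (2 * p.h) • Function.update ξ i a j) w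
        (Function.update ξ i a) i =
      if p.R₁ < Real.sqrt (2 * p.h) * ‖a‖ ∨ p.Mf < f (w i + Real.sqrt (2 * p.h) • a) ∨
          (neighbors p w i : ℝ) < p.Nstar then
        gradient f (w i + Real.sqrt (2 * p.h) • a)
      else (1 / ((Finset.univ.filter fun j => j ≠ i ∧ ‖w j - w i‖ ≤ p.R₂).card : ℝ)) •
        ∑ j ∈ Finset.univ.filter (fun j => j ≠ i ∧ ‖w j - w i‖ ≤ p.R₂),
          sample f p.h p.η (w i + Real.sqrt (2 * p.h) • a) (w j) (ξ j) := by
  unfold force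
  simp only [Function.update_self]
  congr 1
  rw [neighbors]
  congr 1
  rw [← Finset.filter_filter, Finset.sum_filter (fun j => ‖w j - w i‖ ≤ p.R₂)]
  refine Finset.sum_congr rfl fun j hj => ?_
  have hji : j ≠ i := (Finset.mem_filter.1 hj).2
  unfold pairForce sample stencil
  simp only [Function.update_self, Function.update_of_ne hji]
  by_cases h1 : ‖w j - w i‖ ≤ p.R₂
  · simp only [h1, and_true, if_true]
    split_ifs
    · rw [smul_smul]
      congr 1
      ring
    · rw [smul_zero]
  · simp [h1]

/-- The density at a particle compensates the largest inverse density of its neighbours. -/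
lemma density_mul_inverseDensityBound_le {h η R₁ R₂ : ℝ} (hh : 0 < h) (hη : 0 ≤ η)
    (hη' : η ≤ 1 / 20) (hR₂ : 1 ≤ R₂) {a : Space d} (ha : Real.sqrt (2 * h) * ‖a‖ ≤ R₁) :
    density h a * inverseDensityBound d h η R₂ (Real.sqrt (2 * h) * ‖a‖) ≤
      Real.exp (R₂ * (R₂ + R₁) / (2 * h)) * Real.exp (-(1 / (5 * h))) *
        Real.exp (1 / 10 * ‖a‖ ^ 2) := by
  set s := Real.sqrt (2 * h) * ‖a‖ with hs
  have hs0 : 0 ≤ s := by positivity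
  have hs2 : ‖a‖ ^ 2 = s ^ 2 / (2 * h) := by
    rw [hs, mul_pow, Real.sq_sqrt (by positivity)]
    field_simp
  have h1 : density h a * inverseDensityBound d h η R₂ s =
      Real.exp (-‖a‖ ^ 2 / 2) * Real.exp ((s + R₂ + η) ^ 2 / (4 * h)) := by
    have : (4 * Real.pi * h) ^ ((d : ℝ) / 2) ≠ 0 := by positivity
    unfold density inverseDensityBound
    field_simp
  rw [h1, ← Real.exp_add, ← Real.exp_add, ← Real.exp_add, Real.exp_le_exp, hs2]
  have h2 : R₂ * (R₂ + R₁) / (2 * h) + -(1 / (5 * h)) + 1 / 10 * (s ^ 2 / (2 * h)) -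
      (-(s ^ 2 / (2 * h)) / 2 + (s + R₂ + η) ^ 2 / (4 * h)) =
      (2 * R₂ * (R₂ + R₁) - 4 / 5 + s ^ 2 / 5 + s ^ 2 - (s + R₂ + η) ^ 2) / (4 * h) := by
    field_simp
    ring
  -- After `s ≤ R₁` and `2sη ≤ s²/5 + 5η²`, at least `R₂² - R₂/10 - 4/5 - 6η²` is left, positive
  -- since `R₂ ≥ 1` and `η ≤ 1/20`. The spare `R₂²` pays for `exp(-1/(5h))`.
  have h3 : 0 ≤ 2 * R₂ * (R₂ + R₁) - 4 / 5 + s ^ 2 / 5 + s ^ 2 - (s + R₂ + η) ^ 2 := by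
    have e1 : s * R₂ ≤ R₁ * R₂ := by gcongr
    have e2 : 2 * s * η ≤ s ^ 2 / 5 + 5 * η ^ 2 := by nlinarith [sq_nonneg (s - 5 * η)]
    have e3 : η ^ 2 ≤ 1 / 400 := by nlinarith
    have e4 : R₂ * η ≤ R₂ * (1 / 20) := by gcongr
    nlinarith
  have h4 := div_nonneg h3 (by positivity : 0 ≤ 4 * h)
  rw [← h2] at h4
  have h5 : -(s ^ 2 / (2 * h)) / 2 = -(s ^ 2 / (2 * h) / 2) := by ring
  linarith

/-- The contribution of the sampling noise to the mean force error, before the parameters are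
substituted. -/
def noiseBound (d : ℕ) (L q G : ℝ) (p : Params) (n : ℝ) : ℝ :=
  Real.exp (p.R₂ * (p.R₂ + p.R₁) / (2 * p.h)) * Real.exp (-(1 / (5 * p.h))) *
    (p.R₁ / p.η) ^ d * d ^ 2 * (4 * L * G + L ^ 2 * p.η ^ 2 / 2) / (2 * q * n)

lemma volume_closedBall_div (d : ℕ) {R η : ℝ} (hR : 0 ≤ R) (hη : 0 < η) :
    (volume : Measure (Space d)).real (Metric.closedBall 0 R) =
      (R / η) ^ d * (volume : Measure (Space d)).real (Metric.closedBall 0 η) := by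
  rw [Measure.real, Measure.real, Measure.addHaar_closedBall _ _ hR,
    Measure.addHaar_closedBall _ _ hη.le, ENNReal.toReal_mul, ENNReal.toReal_mul,
    finrank_euclideanSpace_fin, ENNReal.toReal_ofReal (by positivity),
    ENNReal.toReal_ofReal (by positivity), div_pow]
  field_simp

/-- The pointwise bound on the mean force error for a particle with increment `a`. -/
lemma conditional_error_le (hh : 0 < p.h) (hL : 0 < L) (hη : 0 < p.η)
    (hη' : p.η ≤ 1 / 20) (hR₁ : 0 < p.R₁) (hR₂ : 1 ≤ p.R₂) (hf : LSmooth L f)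
    (hmin : ∀ x, fstar ≤ f x) {q : ℝ} (hq : 0 < q) {n : ℝ} (hn : 0 < n) {u a : Space d}
    (ha : Real.sqrt (2 * p.h) * ‖a‖ ≤ p.R₁) (hfa : f (u + Real.sqrt (2 * p.h) • a) ≤ p.Mf) :
    (inverseDensityBound d p.h p.η p.R₂ (Real.sqrt (2 * p.h) * ‖a‖) *
        (alpha d p.η * (‖gradient f (u + Real.sqrt (2 * p.h) • a)‖ + L * p.η / 2)) ^ 2 *
          (volume : Measure (Space d)).real (Metric.closedBall 0 p.η)) / n /
          (q / (volume : Measure (Space d)).real (Metric.closedBall 0 p.R₁) *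
            (1 / density p.h a)) / 2 ≤
      noiseBound d L q (p.Mf - fstar) p n * Real.exp (1 / 10 * ‖a‖ ^ 2) := by
  set x := u + Real.sqrt (2 * p.h) • a
  have hV := volume_real_closedBall_pos (d := d) hη
  have hG : (‖gradient f x‖ + L * p.η / 2) ^ 2 ≤
      4 * L * (p.Mf - fstar) + L ^ 2 * p.η ^ 2 / 2 := by
    have h1 := hf.norm_gradient_sq_le hL hmin x
    have h2 : 2 * L * (f x - fstar) ≤ 2 * L * (p.Mf - fstar) := by gcongr
    nlinarith [sq_nonneg (‖gradient f x‖ - L * p.η / 2)]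
  have hK := density_mul_inverseDensityBound_le hh hη.le hη' hR₂ ha
  have hdens := density_pos hh a
  rw [volume_closedBall_div d hR₁.le hη]
  set V := (volume : Measure (Space d)).real (Metric.closedBall 0 p.η)
  set K := inverseDensityBound d p.h p.η p.R₂ (Real.sqrt (2 * p.h) * ‖a‖)
  set G := ‖gradient f x‖ + L * p.η / 2
  -- Division by a parameter proportional to `1/p_i` produces the product `p_i K`; the volumes of
  -- the `η`-ball cancel.
  have e : K * (alpha d p.η * G) ^ 2 * V / n /
      (q / ((p.R₁ / p.η) ^ d * V) * (1 / density p.h a)) / 2 =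
      (density p.h a * K) * ((p.R₁ / p.η) ^ d * d ^ 2 * G ^ 2 / (2 * q * n)) := by
    have : alpha d p.η = d / V := rfl
    rw [this]
    field_simp
  have e' : noiseBound d L q (p.Mf - fstar) p n * Real.exp (1 / 10 * ‖a‖ ^ 2) =
      (Real.exp (p.R₂ * (p.R₂ + p.R₁) / (2 * p.h)) * Real.exp (-(1 / (5 * p.h))) *
        Real.exp (1 / 10 * ‖a‖ ^ 2)) * ((p.R₁ / p.η) ^ d * d ^ 2 *
          (4 * L * (p.Mf - fstar) + L ^ 2 * p.η ^ 2 / 2) / (2 * q * n)) := by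
    rw [noiseBound]
    ring
  rw [e, e']
  refine mul_le_mul hK ?_ (by positivity) (by positivity)
  gcongr

/-- The mean force error for frozen deterministic parts `w`. -/
lemma lintegral_force_error_le (hd : 0 < d) (hh : 0 < p.h) (hL : 0 < L) (hη : 0 < p.η)
    (hη' : p.η ≤ 1 / 20) (hR₁ : 0 < p.R₁) (hR₂ : 1 ≤ p.R₂) (hf : LSmooth L f)
    (hmin : ∀ x, fstar ≤ f x) (hM : fstar ≤ p.Mf) {q : ℝ} (hq : 0 < q) (hN : 0 < p.Nstar)
    {Q : ℝ} (hQ : ∀ n : ℕ, 0 < n → p.Nstar ≤ n →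
      noiseBound d L q (p.Mf - fstar) p n * (5 / 4) ^ ((d : ℝ) / 2) ≤ Q)
    (w : Fin N → Space d) (i : Fin N) :
    ∫⁻ ξ, ‖force p f (fun j => w j + Real.sqrt (2 * p.h) • ξ j) w ξ i -
        gradient f (w i + Real.sqrt (2 * p.h) • ξ i)‖ₑ
        ∂Measure.pi (fun _ : Fin N => stdGaussian (Space d)) ≤
      ENNReal.ofReal (d * L * p.η / 2) + ENNReal.ofReal (q / 2) + ENNReal.ofReal Q := by
  classical
  set c := Real.sqrt (2 * p.h) with hc
  set P := Measure.pi (fun _ : Fin N => stdGaussian (Space d))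
  have hfm : Measurable f := hf.1.continuous.measurable
  have hgm : Measurable (gradient f) := hf.continuous_gradient.measurable
  have hXm : Measurable fun (ξ : Fin N → Space d) (j : Fin N) => w j + c • ξ j :=
    measurable_pi_lambda _ fun j => by fun_prop
  have hΨ : Measurable fun ξ : Fin N → Space d =>
      ‖force p f (fun j => w j + c • ξ j) w ξ i - gradient f (w i + c • ξ i)‖ₑ := by
    refine Measurable.enorm (Measurable.sub ?_ ?_)
    · exact measurable_force p hfm hgm hXm measurable_const measurable_id i
    · exact hgm.comp ((measurable_pi_apply i).comp hXm)
  -- The increment of particle `i` is replaced by an independent copy `a`, integrated last, so that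
  -- `x_i` is fixed while the neighbours are averaged.
  have hup := measurePreserving_update (N := N) (stdGaussian (Space d)) i
  have hΨ' := hΨ.comp hup.measurable
  simp only [Function.comp_def] at hΨ'
  rw [← hup.lintegral_comp hΨ, lintegral_prod _ hΨ'.aemeasurable]
  have hfu := fun ξ a => force_update p f w ξ i a
  simp only [← hc] at hfu
  simp only [hfu, Function.update_self]
  set S := Finset.univ.filter fun j => j ≠ i ∧ ‖w j - w i‖ ≤ p.R₂ with hS
  have hcard : neighbors p w i = S.card := rfl
  rw [hcard]
  by_cases hn : (S.card : ℝ) < p.Nstar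
  · simp [hn]
  simp only [hn, or_false]
  have hn' : p.Nstar ≤ S.card := not_lt.1 hn
  have hn0 : 0 < S.card := by exact_mod_cast hN.trans_le hn'
  have hnR : (0 : ℝ) < S.card := by exact_mod_cast hn0
  set V₁ := (volume : Measure (Space d)).real (Metric.closedBall 0 p.R₁) with hV₁
  have hV₁0 : 0 < V₁ := volume_real_closedBall_pos hR₁
  set B := noiseBound d L q (p.Mf - fstar) p S.card with hB
  have hB0 : 0 ≤ B := by
    have : 0 ≤ p.Mf - fstar := sub_nonneg.2 hM
    rw [hB, noiseBound]
    positivity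
  -- This ball constrains the increment, so importance sampling is later applied with center `0` and
  -- not `w i`.
  let I : Space d → ENNReal := (Metric.closedBall 0 p.R₁).indicator fun _ => 1
  have hIm : Measurable I := measurable_const.indicator measurableSet_closedBall
  have hpt : ∀ a : Space d, ∫⁻ ξ, ‖(if p.R₁ < c * ‖a‖ ∨ p.Mf < f (w i + c • a) then
        gradient f (w i + c • a) else (1 / (S.card : ℝ)) • ∑ j ∈ S,
          sample f p.h p.η (w i + c • a) (w j) (ξ j)) - gradient f (w i + c • a)‖ₑ ∂P ≤
      ENNReal.ofReal (d * L * p.η / 2) +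
        ENNReal.ofReal (q / (2 * V₁)) * (ENNReal.ofReal (1 / density p.h a) * I (0 + c • a)) +
        ENNReal.ofReal B * ENNReal.ofReal (Real.exp (1 / 10 * ‖a‖ ^ 2)) := by
    intro a
    by_cases hbad : p.R₁ < c * ‖a‖ ∨ p.Mf < f (w i + c • a)
    · simp [hbad]
    simp only [hbad, if_false]
    push Not at hbad
    have hdens := density_pos hh a
    have hI : I (0 + c • a) = 1 := by
      refine Set.indicator_of_mem ?_ _
      rw [mem_closedBall_zero_iff, zero_add, norm_smul, Real.norm_of_nonneg (Real.sqrt_nonneg _)]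
      exact hbad.1
    -- The chosen `t`: its integral over the event `√(2h)|a| ≤ R₁` is `q`.
    have ht : 0 < q / V₁ * (1 / density p.h a) := by positivity
    refine (lintegral_ensemble_average_le hd hh hL hη hf (Finset.card_pos.1 hn0)
      (fun j hj => (Finset.mem_filter.1 hj).2.2) ht).trans ?_
    have hcond := conditional_error_le hh hL hη hη' hR₁ hR₂ hf hmin hq hnR hbad.1 hbad.2
    rw [hI, mul_one, ← ENNReal.ofReal_mul (by positivity), ← ENNReal.ofReal_mul hB0,
      ← ENNReal.ofReal_add (by positivity) (by positivity),
      ← ENNReal.ofReal_add (by positivity) (by positivity), add_div, ← add_assoc]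
    refine ENNReal.ofReal_le_ofReal (add_le_add (add_le_add le_rfl (le_of_eq ?_)) hcond)
    field_simp
  refine (lintegral_mono hpt).trans ?_
  rw [lintegral_add_right _ (by fun_prop), lintegral_add_left measurable_const,
    lintegral_const, measure_univ, mul_one, lintegral_const_mul' _ _ ENNReal.ofReal_ne_top,
    lintegral_const_mul' _ _ ENNReal.ofReal_ne_top,
    lintegral_importance hh 0 hIm, lintegral_exp_sq_norm_stdGaussian (by norm_num),
    lintegral_indicator measurableSet_closedBall, setLIntegral_const, one_mul,
    ← ENNReal.ofReal_mul hB0]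
  have h1 : volume (Metric.closedBall (0 : Space d) p.R₁) = ENNReal.ofReal V₁ := by
    rw [hV₁, Measure.real, ENNReal.ofReal_toReal measure_closedBall_lt_top.ne]
  have h2 : q / (2 * V₁) * V₁ = q / 2 := by field_simp
  rw [h1, ← ENNReal.ofReal_mul (by positivity), h2]
  gcongr
  have h3 : (1 / (1 - 2 * (1 / 10)) : ℝ) = 5 / 4 := by norm_num
  rw [h3]
  exact hQ _ hn0 hn'

/-- The choice of the parameters makes the sampling noise small. -/
lemma noiseBound_le (hd : 0 < d) (hL : 0 < L) (hμ : 0 < μ) (hκ : κ = L / μ) (hε : 0 < ε)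
    (hρ0 : 0 < ρ) (hρ1 : ρ < 1) (hh : 0 < p.h) (hhL : p.h ≤ min (1 / L) (1 / (d : ℝ)))
    (hη : 0 < p.η) (hη' : p.η ≤ 1 / 20) (hR₁ : 0 < p.R₁)
    (hN : p.Nstar =
      p.R₁ ^ ((d : ℝ) / (1 - ρ)) * κ ^ (1 / (1 - ρ)) * (d : ℝ) ^ (2 / (1 - ρ)) /
        (μ ^ (1 / (1 - ρ)) * p.η ^ ((d : ℝ) / (1 - ρ)) * ε ^ (2 / (1 - ρ))) *
      Real.exp (p.R₂ * (p.R₂ + p.R₁) / (2 * (1 - ρ) * p.h)))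
    {n : ℕ} (hn0 : 0 < n) (hn : p.Nstar ≤ n) :
    noiseBound d L (μ * ε) (p.Nstar ^ ρ) p n * (5 / 4) ^ ((d : ℝ) / 2) ≤ 6 * (μ * ε) := by
  have hd' : (0 : ℝ) < d := by exact_mod_cast hd
  have hκ0 : 0 < κ := hκ ▸ div_pos hL hμ
  have hρ : 0 < 1 - ρ := by linarith
  set T := p.R₂ * (p.R₂ + p.R₁) / (2 * p.h) with hT
  -- `Nstar = A^(1/(1-ρ))`, that is, `A * Nstar^ρ = Nstar`: the number of neighbours compensates `A`
  -- even when multiplied by the bound `Nstar^ρ` on the excess of `f`.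
  set A := p.R₁ ^ d * κ * (d : ℝ) ^ 2 / (μ * p.η ^ d * ε ^ 2) * Real.exp T with hA
  have hA0 : 0 < A := by positivity
  have hNA : p.Nstar = A ^ (1 / (1 - ρ)) := by
    rw [hN, hA, Real.mul_rpow (by positivity) (by positivity),
      Real.div_rpow (by positivity) (by positivity), Real.mul_rpow (by positivity) (by positivity),
      Real.mul_rpow (by positivity) (by positivity), Real.mul_rpow (by positivity) (by positivity),
      Real.mul_rpow (by positivity) (by positivity), ← Real.rpow_natCast p.R₁ d,
      ← Real.rpow_natCast p.η d, ← Real.rpow_natCast (d : ℝ) 2, ← Real.rpow_natCast ε 2,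
      ← Real.rpow_mul hR₁.le, ← Real.rpow_mul hη.le, ← Real.rpow_mul hd'.le,
      ← Real.rpow_mul hε.le, ← Real.exp_mul]
    have e1 : (d : ℝ) * (1 / (1 - ρ)) = d / (1 - ρ) := by ring
    have e2 : ((2 : ℕ) : ℝ) * (1 / (1 - ρ)) = 2 / (1 - ρ) := by push_cast; ring
    have e3 : T * (1 / (1 - ρ)) = p.R₂ * (p.R₂ + p.R₁) / (2 * (1 - ρ) * p.h) := by
      rw [hT]; field_simp
    rw [e1, e2, e3]
  have hN0 : 0 < p.Nstar := by rw [hNA]; positivity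
  have hAN : A * p.Nstar ^ ρ = p.Nstar := by
    have : A = p.Nstar ^ (1 - ρ) := by
      rw [hNA, ← Real.rpow_mul hA0.le, one_div_mul_cancel hρ.ne', Real.rpow_one]
    rw [this, ← Real.rpow_add hN0, sub_add_cancel, Real.rpow_one]
  have hn1 : (1 : ℝ) ≤ n := by exact_mod_cast hn0
  -- If `A ≤ 1`, the threshold `Nstar` may lie below `A`; then `n ≥ 1` is used instead.
  have hAn : A ≤ n := by
    rcases le_total A 1 with h | h
    · exact h.trans hn1
    · refine le_trans ?_ hn
      rw [hNA]
      exact Real.self_le_rpow_of_one_le h (by rw [le_div_iff₀ hρ]; linarith)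
  have hnpos : (0 : ℝ) < n := by linarith
  set δ := Real.exp (-(1 / (5 * p.h))) * (5 / 4 : ℝ) ^ ((d : ℝ) / 2) with hδ
  have hδ0 : 0 < δ := by positivity
  -- Both `d` and `L` are at most `1/h`, and `1/5 - 1/8 = 3/40`; the decay left over in `L` absorbs
  -- one factor `L` below.
  have hδL : δ ≤ Real.exp (-(3 / 40 * L)) := by
    have h1 : (5 / 4 : ℝ) ^ ((d : ℝ) / 2) ≤ Real.exp (d / 8) := by
      calc (5 / 4 : ℝ) ^ ((d : ℝ) / 2) ≤ (Real.exp (1 / 4)) ^ ((d : ℝ) / 2) := by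
            gcongr
            linarith [Real.add_one_le_exp (1 / 4 : ℝ)]
        _ = Real.exp (d / 8) := by rw [← Real.exp_mul]; ring_nf
    have hL' : L ≤ 1 / p.h := (le_one_div hL hh).2 (hhL.trans (min_le_left _ _))
    have hd'' : (d : ℝ) ≤ 1 / p.h := (le_one_div hd' hh).2 (hhL.trans (min_le_right _ _))
    calc δ ≤ Real.exp (-(1 / (5 * p.h))) * Real.exp (d / 8) := by rw [hδ]; gcongr
      _ = Real.exp (-(1 / (5 * p.h)) + d / 8) := (Real.exp_add _ _).symm
      _ ≤ _ := by
        rw [Real.exp_le_exp]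
        have : 1 / (5 * p.h) = 1 / 5 * (1 / p.h) := by field_simp
        rw [this]
        linarith
  have hδ1 : δ ≤ 1 := hδL.trans (Real.exp_le_one_iff.2 (by linarith))
  have hLδ : L * δ ≤ 40 / 3 := by
    have h1 := Real.add_one_le_exp (3 / 40 * L)
    have h2 : δ * Real.exp (3 / 40 * L) ≤ 1 := by
      calc δ * Real.exp (3 / 40 * L) ≤ Real.exp (-(3 / 40 * L)) * Real.exp (3 / 40 * L) := by
            gcongr
        _ = 1 := by rw [← Real.exp_add, neg_add_cancel, Real.exp_zero]
    nlinarith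
  have e : noiseBound d L (μ * ε) (p.Nstar ^ ρ) p n * (5 / 4) ^ ((d : ℝ) / 2) =
      μ * ε * (2 * (A * p.Nstar ^ ρ / n) * δ + A / n * (p.η ^ 2 * (L * δ)) / 4) := by
    rw [noiseBound, hδ, ← hT, hA, hκ, div_pow]
    field_simp
    ring
  rw [e, hAN, mul_comm 6]
  have h1 : p.Nstar / n ≤ 1 := div_le_one_of_le₀ hn hnpos.le
  have h2 : A / n ≤ 1 := div_le_one_of_le₀ hAn hnpos.le
  have h3 : p.η ^ 2 ≤ 1 := by nlinarith
  have h4 : p.Nstar / n * δ ≤ 1 * 1 := by gcongr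
  have h5 : A / n * (p.η ^ 2 * (L * δ)) ≤ 1 * (1 * (40 / 3)) := by gcongr
  gcongr
  -- The two terms are at most `2` and `(40/3)/4 = 10/3`.
  linarith

end ForceError

/-! ### Coupling of the two methods -/

section Coupling

variable {d N : ℕ} {L μ κ fstar ε ρ : ℝ} {f : Space d → ℝ} {p : Params}

/-- The deterministic parts `w` used in the step from time `m` to time `m + 1`. -/
def deterministicPart (p : Params) (f : Space d → ℝ) (x₀ : Fin N → Space d)
    (ξ : ℕ → Fin N → Space d) (m : ℕ) (i : Fin N) : Space d :=
  (ensembleState p f x₀ ξ m).1 i - p.h • (ensembleState p f x₀ ξ m).2 i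

lemma ensembleState_succ_fst (p : Params) (f : Space d → ℝ) (x₀ : Fin N → Space d)
    (ξ : ℕ → Fin N → Space d) (m : ℕ) :
    (ensembleState p f x₀ ξ (m + 1)).1 =
      fun i => deterministicPart p f x₀ ξ m i + Real.sqrt (2 * p.h) • ξ m i := rfl

lemma ensembleState_succ_snd (p : Params) (f : Space d → ℝ) (x₀ : Fin N → Space d)
    (ξ : ℕ → Fin N → Space d) (m : ℕ) :
    (ensembleState p f x₀ ξ (m + 1)).2 =
      force p f (fun i => deterministicPart p f x₀ ξ m i + Real.sqrt (2 * p.h) • ξ m i)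
        (deterministicPart p f x₀ ξ m) (ξ m) := rfl

section Measurability

variable {α : Type*} [MeasurableSpace α] {x₀ : Fin N → α → Space d}
  {ξ : ℕ → Fin N → α → Space d}

/-- Only the increments before time `m` are assumed measurable, so the lemma also applies to the
σ-algebra generated by the past, which yields independence from the current noise. -/
lemma measurable_ensembleState (p : Params) (hf : Measurable f) (hg : Measurable (gradient f))
    (hx : ∀ i, Measurable (x₀ i)) {m : ℕ} (hξ : ∀ n < m, ∀ i, Measurable (ξ n i)) :
    Measurable fun a => ensembleState p f (fun j => x₀ j a) (fun n j => ξ n j a) m := by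
  induction m with
  | zero =>
    exact (measurable_pi_lambda _ hx).prodMk (measurable_pi_lambda _ fun i => hg.comp (hx i))
  | succ m ih =>
    have hs := ih fun n hn => hξ n (hn.trans (Nat.lt_succ_self m))
    have hs1 := measurable_pi_iff.1 hs.fst
    have hs2 := measurable_pi_iff.1 hs.snd
    have hξm : Measurable fun a => fun j => ξ m j a :=
      measurable_pi_lambda _ (hξ m (Nat.lt_succ_self m))
    have hw : Measurable fun a =>
        deterministicPart p f (fun j => x₀ j a) (fun n j => ξ n j a) m :=
      measurable_pi_lambda _ fun i => (hs1 i).sub ((hs2 i).const_smul p.h)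
    have hX : Measurable fun a => fun i =>
        deterministicPart p f (fun j => x₀ j a) (fun n j => ξ n j a) m i +
          Real.sqrt (2 * p.h) • ξ m i a :=
      measurable_pi_lambda _ fun i => (measurable_pi_iff.1 hw i).add
        ((measurable_pi_iff.1 hξm i).const_smul (Real.sqrt (2 * p.h)))
    exact hX.prodMk (measurable_pi_lambda _ fun i => measurable_force p hf hg hX hw hξm i)

lemma measurable_deterministicPart (p : Params) (hf : Measurable f)
    (hg : Measurable (gradient f)) (hx : ∀ i, Measurable (x₀ i)) {m : ℕ}
    (hξ : ∀ n < m, ∀ i, Measurable (ξ n i)) :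
    Measurable fun a => deterministicPart p f (fun j => x₀ j a) (fun n j => ξ n j a) m := by
  have hs := measurable_ensembleState p hf hg hx hξ
  exact measurable_pi_lambda _ fun i =>
    (measurable_pi_iff.1 hs.fst i).sub ((measurable_pi_iff.1 hs.snd i).const_smul p.h)

lemma measurable_langevin (h : ℝ) (hg : Measurable (gradient f)) (hx : ∀ i, Measurable (x₀ i))
    (hξ : ∀ n i, Measurable (ξ n i)) (m : ℕ) (i : Fin N) :
    Measurable fun a => langevin h f (fun j => x₀ j a) (fun n j => ξ n j a) m i := by
  induction m with
  | zero => exact hx i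
  | succ m ih =>
    simp only [langevin]
    exact (ih.sub ((hg.comp ih).const_smul h)).add ((hξ m i).const_smul (Real.sqrt (2 * h)))

end Measurability

section Driving

variable {Ω : Type*} [MeasurableSpace Ω] {P : Measure Ω}
  {ν : Measure (Space d)} {x₀ : Fin N → Ω → Space d} {ξ : ℕ → Fin N → Ω → Space d}

/-- The deterministic parts of a step are independent of the increments of that step. -/
lemma IsDriving.indepFun_deterministicPart (hD : IsDriving P ν x₀ ξ) (p : Params)
    (hf : Measurable f) (hg : Measurable (gradient f)) (m : ℕ) :
    IndepFun (fun ω => deterministicPart p f (fun j => x₀ j ω) (fun n j => ξ n j ω) m)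
      (fun ω j => ξ m j ω) P := by
  set Z : Fin N ⊕ (ℕ × Fin N) → Ω → Space d :=
    Sum.elim x₀ (fun q : ℕ × Fin N => ξ q.1 q.2) with hZ
  have hle : ∀ k, MeasurableSpace.comap (Z k) inferInstance ≤
      (inferInstance : MeasurableSpace Ω) := by
    rintro (i | q)
    · exact (hD.measurable_init i).comap_le
    · exact (hD.measurable_noise q.1 q.2).comap_le
  -- `S` indexes the initial positions and the noise before time `m`, `T` the noise at time `m`.
  let S : Set (Fin N ⊕ (ℕ × Fin N)) := {k | ∀ q, k = Sum.inr q → q.1 < m}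
  let T : Set (Fin N ⊕ (ℕ × Fin N)) := {k | ∃ j, k = Sum.inr (m, j)}
  have hST : Disjoint S T := by
    rw [Set.disjoint_left]
    rintro k hk ⟨j, rfl⟩
    exact lt_irrefl _ (hk _ rfl)
  have hind := indep_iSup_of_disjoint hle hD.indep.iIndep hST
  have hcoord : ∀ (U : Set (Fin N ⊕ (ℕ × Fin N))), ∀ k ∈ U,
      Measurable[⨆ k ∈ U, MeasurableSpace.comap (Z k) inferInstance] (Z k) := fun U k hk =>
    (comap_measurable (Z k)).mono (le_iSup₂_of_le k hk le_rfl) le_rfl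
  rw [IndepFun_iff_Indep]
  refine indep_of_indep_of_le_left (indep_of_indep_of_le_right hind ?_) ?_
  · refine Measurable.comap_le ?_
    exact @measurable_pi_lambda _ _ _ (_) _ _ fun j => hcoord T (Sum.inr (m, j)) ⟨j, rfl⟩
  · refine Measurable.comap_le ?_
    -- The underscore for the measurable space is the σ-algebra generated by `S`, not the ambient
    -- one on `Ω`.
    refine @measurable_deterministicPart _ _ _ _ (_) _ _ p hf hg (fun i => ?_) m fun n hn i => ?_
    · exact hcoord S (Sum.inl i) fun q hq => by cases hq
    · refine hcoord S (Sum.inr (n, i)) fun q hq => ?_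
      cases hq
      exact hn

lemma IsDriving.map_noise [IsProbabilityMeasure P] (hD : IsDriving P ν x₀ ξ) (m : ℕ) :
    P.map (fun ω j => ξ m j ω) = Measure.pi fun _ : Fin N => stdGaussian (Space d) := by
  have h : iIndepFun (fun j : Fin N => ξ m j) P :=
    hD.indep.precomp (g := fun j : Fin N => Sum.inr (m, j)) fun i j hij => by
      simpa using hij
  rw [(iIndepFun_iff_map_fun_eq_pi_map fun j => (hD.measurable_noise m j).aemeasurable).1 h]
  simp_rw [hD.law_noise]

/-- A bound on the mean force error for frozen deterministic parts is a bound on the mean force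
error of the ensemble. -/
lemma IsDriving.lintegral_force_error_le [IsProbabilityMeasure P] (hD : IsDriving P ν x₀ ξ)
    (hf : Measurable f) (hg : Measurable (gradient f)) (i : Fin N) {E : ENNReal}
    (hE : ∀ w : Fin N → Space d,
      ∫⁻ ξ, ‖force p f (fun j => w j + Real.sqrt (2 * p.h) • ξ j) w ξ i -
        gradient f (w i + Real.sqrt (2 * p.h) • ξ i)‖ₑ
        ∂Measure.pi (fun _ : Fin N => stdGaussian (Space d)) ≤ E) (m : ℕ) :
    ∫⁻ ω, ‖(ensembleState p f (fun j => x₀ j ω) (fun n j => ξ n j ω) m).2 i -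
      gradient f ((ensembleState p f (fun j => x₀ j ω) (fun n j => ξ n j ω) m).1 i)‖ₑ ∂P ≤ E := by
  cases m with
  | zero => simp [ensembleState]
  | succ m =>
    let Φ : (Fin N → Space d) × (Fin N → Space d) → ENNReal := fun q =>
      ‖force p f (fun j => q.1 j + Real.sqrt (2 * p.h) • q.2 j) q.1 q.2 i -
        gradient f (q.1 i + Real.sqrt (2 * p.h) • q.2 i)‖ₑ
    have hX : Measurable fun (q : (Fin N → Space d) × (Fin N → Space d)) (j : Fin N) =>
        q.1 j + Real.sqrt (2 * p.h) • q.2 j :=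
      measurable_pi_lambda _ fun j => by fun_prop
    have hΦ : Measurable Φ := ((measurable_force p hf hg hX measurable_fst measurable_snd i).sub
      (hg.comp ((measurable_pi_apply i).comp hX))).enorm
    have hW := measurable_deterministicPart p hf hg hD.measurable_init
      (m := m) fun n _ j => hD.measurable_noise n j
    have hΞ : Measurable fun (ω : Ω) (j : Fin N) => ξ m j ω :=
      measurable_pi_lambda _ (hD.measurable_noise m)
    have hlaw := (indepFun_iff_map_prod_eq_prod_map_map hW.aemeasurable hΞ.aemeasurable).1
      (hD.indepFun_deterministicPart p hf hg m)
    rw [hD.map_noise m] at hlaw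
    have := Measure.isProbabilityMeasure_map (μ := P) hW.aemeasurable
    simp only [ensembleState_succ_fst, ensembleState_succ_snd]
    change ∫⁻ ω, Φ (deterministicPart p f (fun j => x₀ j ω) (fun n j => ξ n j ω) m,
      fun j => ξ m j ω) ∂P ≤ E
    -- The joint law of `w` and the noise is a product, so the bound for frozen `w` applies to every
    -- inner integral.
    rw [← lintegral_map hΦ (hW.prodMk hΞ), hlaw, lintegral_prod _ hΦ.aemeasurable]
    exact (lintegral_mono fun w => hE w).trans (by simp)

end Driving

end Coupling

end CEnLMC
end

/-! ### The recursion for the mean distance between the two methods. -/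

theorem mainTheorem6 :
    ∃ C : ℝ, 0 < C ∧ ∃ ε₀ : ℝ, 0 < ε₀ ∧
      ∀ (d N : ℕ) (Ω : Type*) [MeasurableSpace Ω] (P : Measure Ω) [IsProbabilityMeasure P]
        (ν : Measure (CEnLMC.Space d)) (x₀ : Fin N → Ω → CEnLMC.Space d)
        (ξ : ℕ → Fin N → Ω → CEnLMC.Space d) (f : CEnLMC.Space d → ℝ)
        (L μ κ fstar ε ρ : ℝ) (p : CEnLMC.Params),
        0 < d →
        CEnLMC.IsDriving P ν x₀ ξ →
        0 < L → CEnLMC.LSmooth L f →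
        0 < μ → StrongConvexOn Set.univ μ f →
        κ = L / μ →
        IsLeast (Set.range f) fstar →
        0 < ε → ε ≤ ε₀ →
        0 < ρ → ρ < 1 →
        0 < p.h → p.h ≤ min (1 / L) (1 / (d : ℝ)) →
        0 < p.R₁ →
        0 < p.η → max p.η 1 ≤ p.R₂ →
        p.η < ε / (κ * d) →
        p.Nstar =
          p.R₁ ^ ((d : ℝ) / (1 - ρ)) * κ ^ (1 / (1 - ρ)) * (d : ℝ) ^ (2 / (1 - ρ)) /
            (μ ^ (1 / (1 - ρ)) * p.η ^ ((d : ℝ) / (1 - ρ)) * ε ^ (2 / (1 - ρ))) *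
          Real.exp (p.R₂ * (p.R₂ + p.R₁) / (2 * (1 - ρ) * p.h)) →
        p.Mf = p.Nstar ^ ρ + fstar →
        ∀ (m : ℕ) (i : Fin N),
          Integrable (fun ω =>
            ‖CEnLMC.ensemble p f (fun j => x₀ j ω) (fun n j => ξ n j ω) m i -
              CEnLMC.langevin p.h f (fun j => x₀ j ω) (fun n j => ξ n j ω) m i‖) P ∧
          ∫ ω, ‖CEnLMC.ensemble p f (fun j => x₀ j ω) (fun n j => ξ n j ω) m i -
              CEnLMC.langevin p.h f (fun j => x₀ j ω) (fun n j => ξ n j ω) m i‖ ∂P ≤ C * ε := by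
  -- `14ε` solves `(hμ/2) c = h * 7με`; `ε ≤ 1/20` forces `η ≤ 1/20`, as `κd ≥ 1`.
  refine ⟨14, by norm_num, 1 / 20, by norm_num, ?_⟩
  intro d N Ω _ P _ ν x₀ ξ f L μ κ fstar ε ρ p hd hD hL hf hμ hc hκ hleast hε hε₀ hρ0 hρ1 hh hhL
    hR₁ hη hR₂ hηε hN hM m i
  have hd1 : (1 : ℝ) ≤ d := by exact_mod_cast hd
  have hμL : μ ≤ L := CEnLMC.modulus_le_of_smooth hd hf hc
  have hκ1 : 1 ≤ κ := by rw [hκ, le_div_iff₀ hμ, one_mul]; exact hμL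
  have hκd : 1 ≤ κ * d := by nlinarith
  have hη' : p.η ≤ 1 / 20 := hηε.le.trans ((div_le_self hε.le hκd).trans hε₀)
  have hfm : Measurable f := hf.1.continuous.measurable
  have hgm : Measurable (gradient f) := hf.continuous_gradient.measurable
  have hN0 : 0 < p.Nstar := by
    have : 0 < κ := by linarith
    rw [hN]
    positivity
  have hMf : p.Mf - fstar = p.Nstar ^ ρ := by rw [hM]; ring
  have hM0 : fstar ≤ p.Mf := by
    have : 0 < p.Nstar ^ ρ := by positivity
    linarith
  have hbias : d * L * p.η / 2 ≤ μ * ε / 2 := by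
    rw [lt_div_iff₀ (by linarith), hκ] at hηε
    have h1 : p.η * (L / μ * d) * μ ≤ ε * μ := by gcongr
    have h2 : p.η * (L / μ * d) * μ = d * L * p.η := by field_simp
    linarith
  -- The constant is `7 = 1/2 + 1/2 + 6`: bias, the integral of `t/2` with `q = με`, and sampling
  -- noise.
  have hforce : ∀ m, ∫⁻ ω, ‖(CEnLMC.ensembleState p f (fun j => x₀ j ω) (fun n j => ξ n j ω) m).2 i -
      gradient f ((CEnLMC.ensembleState p f (fun j => x₀ j ω) (fun n j => ξ n j ω) m).1 i)‖ₑ ∂P ≤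
      ENNReal.ofReal (7 * (μ * ε)) := by
    refine hD.lintegral_force_error_le hfm hgm i fun w => ?_
    refine (CEnLMC.lintegral_force_error_le (Q := 6 * (μ * ε)) hd hh hL hη hη' hR₁
      ((le_max_right _ _).trans hR₂) hf (fun x => hleast.2 ⟨x, rfl⟩) hM0 (mul_pos hμ hε) hN0
      (fun n hn0 hn => ?_) w i).trans ?_
    · rw [hMf]
      exact CEnLMC.noiseBound_le hd hL hμ hκ hε hρ0 hρ1 hh hhL hη hη' hR₁ hN hn0 hn
    · rw [← ENNReal.ofReal_add (by positivity) (by positivity),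
        ← ENNReal.ofReal_add (by positivity) (by positivity)]
      refine ENNReal.ofReal_le_ofReal ?_
      linarith
  have hhL' : p.h ≤ 1 / L := hhL.trans (min_le_left _ _)
  have hhμ : p.h * μ ≤ 1 := by
    calc p.h * μ ≤ 1 / L * L := by gcongr
      _ = 1 := by field_simp
  have hens : ∀ m, Measurable fun ω =>
      CEnLMC.ensembleState p f (fun j => x₀ j ω) (fun n j => ξ n j ω) m := fun m =>
    CEnLMC.measurable_ensembleState p hfm hgm hD.measurable_init fun n _ j =>
      hD.measurable_noise n j
  have hlan := CEnLMC.measurable_langevin (f := f) p.h hgm hD.measurable_init hD.measurable_noise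
  have hdiff : ∀ m, Measurable fun ω =>
      CEnLMC.ensemble p f (fun j => x₀ j ω) (fun n j => ξ n j ω) m i -
        CEnLMC.langevin p.h f (fun j => x₀ j ω) (fun n j => ξ n j ω) m i := fun m =>
    (measurable_pi_iff.1 (hens m).fst i).sub (hlan m i)
  -- With the lower integral the induction needs no integrability, which is instead a consequence.
  -- The initial positions need no moments, since the difference starts at `0`.
  have hmain : ∀ m, ∫⁻ ω, ‖CEnLMC.ensemble p f (fun j => x₀ j ω) (fun n j => ξ n j ω) m i -
      CEnLMC.langevin p.h f (fun j => x₀ j ω) (fun n j => ξ n j ω) m i‖ₑ ∂P ≤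
      ENNReal.ofReal (14 * ε) := by
    intro m
    induction m with
    | zero => simp [CEnLMC.ensemble, CEnLMC.ensembleState, CEnLMC.langevin]
    | succ m ih =>
      have hstep : ∀ ω,
          ‖CEnLMC.ensemble p f (fun j => x₀ j ω) (fun n j => ξ n j ω) (m + 1) i -
            CEnLMC.langevin p.h f (fun j => x₀ j ω) (fun n j => ξ n j ω) (m + 1) i‖ₑ ≤
          ENNReal.ofReal (1 - p.h * μ / 2) *
            ‖CEnLMC.ensemble p f (fun j => x₀ j ω) (fun n j => ξ n j ω) m i -
              CEnLMC.langevin p.h f (fun j => x₀ j ω) (fun n j => ξ n j ω) m i‖ₑ +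
          ENNReal.ofReal p.h *
            ‖(CEnLMC.ensembleState p f (fun j => x₀ j ω) (fun n j => ξ n j ω) m).2 i -
              gradient f
                ((CEnLMC.ensembleState p f (fun j => x₀ j ω) (fun n j => ξ n j ω) m).1 i)‖ₑ := by
        intro ω
        simp only [CEnLMC.ensemble, CEnLMC.ensembleState_succ_fst, CEnLMC.deterministicPart,
          CEnLMC.langevin]
        set x := (CEnLMC.ensembleState p f (fun j => x₀ j ω) (fun n j => ξ n j ω) m).1 i
        set F := (CEnLMC.ensembleState p f (fun j => x₀ j ω) (fun n j => ξ n j ω) m).2 i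
        set z := CEnLMC.langevin p.h f (fun j => x₀ j ω) (fun n j => ξ n j ω) m i
        have h1 := CEnLMC.norm_gradient_step_le hL hμ hf hc hh hhL' hhμ x z
        have e : x - p.h • F + Real.sqrt (2 * p.h) • ξ m i ω -
            (z - p.h • gradient f z + Real.sqrt (2 * p.h) • ξ m i ω) =
            ((x - p.h • gradient f x) - (z - p.h • gradient f z)) -
              p.h • (F - gradient f x) := by module
        rw [e, ← ofReal_norm, ← ofReal_norm, ← ofReal_norm,
          ← ENNReal.ofReal_mul (by linarith), ← ENNReal.ofReal_mul hh.le,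
          ← ENNReal.ofReal_add (mul_nonneg (by linarith) (norm_nonneg _)) (by positivity)]
        refine ENNReal.ofReal_le_ofReal ((norm_sub_le _ _).trans (add_le_add h1 ?_))
        rw [norm_smul, Real.norm_of_nonneg hh.le]
      refine (lintegral_mono hstep).trans ?_
      rw [lintegral_add_left ((hdiff m).enorm.const_mul _),
        lintegral_const_mul _ (hdiff m).enorm, lintegral_const_mul']
      · calc _ ≤ ENNReal.ofReal (1 - p.h * μ / 2) * ENNReal.ofReal (14 * ε) +
              ENNReal.ofReal p.h * ENNReal.ofReal (7 * (μ * ε)) := by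
              gcongr
              exact hforce m
          _ = ENNReal.ofReal (14 * ε) := by
              rw [← ENNReal.ofReal_mul (by linarith), ← ENNReal.ofReal_mul hh.le,
                ← ENNReal.ofReal_add (mul_nonneg (by linarith) (by positivity)) (by positivity)]
              congr 1
              ring
      · exact ENNReal.ofReal_ne_top
  have hint : Integrable (fun ω => CEnLMC.ensemble p f (fun j => x₀ j ω) (fun n j => ξ n j ω) m i -
      CEnLMC.langevin p.h f (fun j => x₀ j ω) (fun n j => ξ n j ω) m i) P :=
    ⟨(hdiff m).aestronglyMeasurable, (hmain m).trans_lt ENNReal.ofReal_lt_top⟩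
  refine ⟨hint.norm, ?_⟩
  rw [integral_norm_eq_lintegral_enorm (hdiff m).aestronglyMeasurable]
  exact ENNReal.toReal_le_of_le_ofReal (by positivity) (hmain m)
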